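/- Let $n\ge 2$. There exist $r_0>0$ and $C<\infty$, both depending only on $n$, such that the following holds. Let $\Omega\subset\mathbb R^n$ be open, $T>0$, $\Omega_T=\Omega\times(0,T)$, $f\in L^1_{loc}(\Omega)$ (independent of time), and let $u\in C((0,T);L^2(\Omega))\cap L^n(0,T;W^{1,n}(\Omega))$ be a (scalar) weak solution of $$u_t-\operatorname{div}\big(|\nabla u|^{n-2}\nabla u\big)=f(x)\quad\text{in }\Omega_T,$$ that is, $\iint_{\Omega_T} f\varphi\,dz=-\iint_{\Omega_T} u\,\varphi_t\,dz+\iint_{\Omega_T}\langle|\nabla u|^{n-2}\nabla u,\nabla\varphi\rangle\,dz$ for all $\varphi\in C^1_c(\Omega_T)$. Let $z_0=(x_0,t_0)$, $\lambda\ge1$, $r\in(0,r_0)$, put $$B_r=B_r(x_0),\quad I_r^\lambda=(t_0-\lambda^{2-n}r^2,\;t_0+\lambda^{2-n}r^2),\quad Q_r^\lambda=B_r\times I_r^\lambda ,$$ and suppose that $Q_r^\lambda\subset\Omega_T$. Let $v\in C(I_r^\lambda;L^2(B_r))\cap L^n(I_r^\lambda;W^{1,n}(B_r))$ be a weak solution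 of $$v_t-\operatorname{div}\big(|\nabla v|^{n-2}\nabla v\big)=0\ \text{ in }Q_r^\lambda,\qquad v=u\ \text{ on the parabolic boundary of }Q_r^\lambda,$$ where the boundary condition means that $(u-v)(\cdot,t)\in W^{1,n}_0(B_r)$ for almost every $t\in I_r^\lambda$ and $\|(u-v)(\cdot,t)\|_{L^2(B_r)}\to0$ as $t\downarrow t_0-\lambda^{2-n}r^2$. Then $$\Big(\frac1{|Q_r^\lambda|}\iint_{Q_r^\lambda}|\nabla u-\nabla v|^n\,dz\Big)^{\frac1n}\le C\,\Big(\frac1{|B_r|}\int_{B_r} r|f|\,\log\Big(e+\frac{|f|}{\frac1{|B_r|}\int_{B_r}|f|\,dy}\Big)dx\Big)^{\frac1{n-1}}.$$ Here the integrand on the right is $0$ where $f=0$; if the right-hand side is infinite, nothing is claimed. -/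

import Mathlib

open MeasureTheory Set Filter Topology
open scoped ENNReal NNReal ContDiff

noncomputable section

namespace ParabolicPLaplace

/-- Euclidean space `ℝⁿ`. -/
abbrev Space (n : ℕ) := EuclideanSpace ℝ (Fin n)

/-- `w ∈ W^{1,q}(U)` with weak gradient `G` on the open set `U`. -/
structure HasWeakGradient {n : ℕ} (q : ℝ≥0∞) (U : Set (Space n))
    (w : Space n → ℝ) (G : Space n → Space n) : Prop where
  memLp : MemLp w q (volume.restrict U)
  memLp_grad : MemLp G q (volume.restrict U)
  integral_by_parts : ∀ φ : Space n → ℝ, ContDiff ℝ ∞ φ → HasCompactSupport φ → tsupport φ ⊆ U →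
    ∀ e : Space n,
      ∫ x in U, w x * fderiv ℝ φ x e = - ∫ x in U, inner ℝ (G x) e * φ x

/-- `w ∈ W₀^{1,q}(U)` with weak gradient `G`: the pair `(w, G)` is the limit in `L^q(U)` of
`(φₖ, ∇φₖ)` for test functions `φₖ ∈ C_c^∞(U)`. -/
def HasZeroTrace {n : ℕ} (q : ℝ≥0∞) (U : Set (Space n))
    (w : Space n → ℝ) (G : Space n → Space n) : Prop :=
  ∃ φ : ℕ → Space n → ℝ,
    (∀ k, ContDiff ℝ ∞ (φ k) ∧ HasCompactSupport (φ k) ∧ tsupport (φ k) ⊆ U) ∧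
    Tendsto (fun k => eLpNorm (fun x => φ k x - w x) q (volume.restrict U)) atTop (𝓝 0) ∧
    Tendsto (fun k => eLpNorm (fun x => gradient (φ k) x - G x) q (volume.restrict U))
      atTop (𝓝 0)

/-- `u ∈ C((a,b); L²(U))`. -/
structure ContinuousInL2 {n : ℕ} (U : Set (Space n)) (a b : ℝ) (u : Space n → ℝ → ℝ) : Prop where
  memLp : ∀ t ∈ Ioo a b, MemLp (fun x => u x t) 2 (volume.restrict U)
  tendsto : ∀ s ∈ Ioo a b,
    Tendsto (fun t => eLpNorm (fun x => u x t - u x s) 2 (volume.restrict U)) (𝓝 s) (𝓝 0)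

/-- `u ∈ L^q(a,b; W^{1,q}(U))` with weak spatial gradient `Du`. -/
structure InLqW1q {n : ℕ} (q : ℝ≥0∞) (U : Set (Space n)) (a b : ℝ)
    (u : Space n → ℝ → ℝ) (Du : Space n → ℝ → Space n) : Prop where
  memLp : MemLp (fun z : Space n × ℝ => u z.1 z.2) q (volume.restrict (U ×ˢ Ioo a b))
  memLp_grad : MemLp (fun z : Space n × ℝ => Du z.1 z.2) q (volume.restrict (U ×ˢ Ioo a b))
  slice : ∀ᵐ t ∂(volume.restrict (Ioo a b)),
    HasWeakGradient q U (fun x => u x t) (fun x => Du x t)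

/-- The `p`-Laplace vector field `ζ ↦ |ζ|^{p-2} ζ`. -/
def flux {n : ℕ} (p : ℝ) (ζ : Space n) : Space n := ‖ζ‖ ^ (p - 2) • ζ

/-- `u`, with weak spatial gradient `Du`, is a weak solution of
`u_t - div (|∇u|^{p-2} ∇u) = f(x)` in `U × (a,b)`, where `f ∈ L¹_loc(U)` does not depend on time.

In the equation, `fderiv ℝ φ z (0, 1)` is `∂ₜφ(z)` and `fderiv ℝ φ z (ζ, 0)` is `⟨ζ, ∇φ(z)⟩`. -/
structure IsWeakSolution {n : ℕ} (p : ℝ) (U : Set (Space n)) (a b : ℝ) (f : Space n → ℝ)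
    (u : Space n → ℝ → ℝ) (Du : Space n → ℝ → Space n) : Prop where
  datum : LocallyIntegrableOn f U
  continuousInL2 : ContinuousInL2 U a b u
  inLqW1q : InLqW1q (ENNReal.ofReal p) U a b u Du
  equation : ∀ φ : Space n × ℝ → ℝ, ContDiff ℝ 1 φ → HasCompactSupport φ →
    tsupport φ ⊆ U ×ˢ Ioo a b →
      ∫ z in U ×ˢ Ioo a b, f z.1 * φ z =
        - (∫ z in U ×ˢ Ioo a b, u z.1 z.2 * fderiv ℝ φ z (0, 1)) +
          ∫ z in U ×ˢ Ioo a b, fderiv ℝ φ z (flux p (Du z.1 z.2), 0)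

/-- `v`, with weak spatial gradient `Dv`, is a weak solution of the Cauchy-Dirichlet problem
`v_t - div (|∇v|^{p-2} ∇v) = 0` in `U × (a,b)`, `v = u` on the parabolic boundary
`(U × {a}) ∪ (∂U × (a,b))`: the lateral condition is `u(·,t) - v(·,t) ∈ W₀^{1,p}(U)` for almost
every `t`, the initial condition is `u(·,t) - v(·,t) → 0` in `L²(U)` as `t ↓ a`. -/
structure IsHomogeneousReplacement {n : ℕ} (p : ℝ) (U : Set (Space n)) (a b : ℝ)
    (u : Space n → ℝ → ℝ) (Du : Space n → ℝ → Space n)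
    (v : Space n → ℝ → ℝ) (Dv : Space n → ℝ → Space n) : Prop where
  solution : IsWeakSolution p U a b (fun _ => 0) v Dv
  lateral : ∀ᵐ t ∂(volume.restrict (Ioo a b)),
    HasZeroTrace (ENNReal.ofReal p) U (fun x => u x t - v x t) (fun x => Du x t - Dv x t)
  initial : Tendsto (fun t => eLpNorm (fun x => u x t - v x t) 2 (volume.restrict U))
    (𝓝[>] a) (𝓝 0)

/-- The intrinsic cylinder `Q_r^μ(x₀,t₀) = B_r(x₀) × (t₀ - μ^{2-p} r², t₀ + μ^{2-p} r²)`. -/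
def cylinder {n : ℕ} (p μ r : ℝ) (x₀ : Space n) (t₀ : ℝ) : Set (Space n × ℝ) :=
  Metric.ball x₀ r ×ˢ Ioo (t₀ - μ ^ (2 - p) * r ^ 2) (t₀ + μ ^ (2 - p) * r ^ 2)

end ParabolicPLaplace

end

namespace ParabolicPLaplace

/-! Put `w = u - v`, `G = Du - Dv` and `A = |Du|^{n-2} Du - |Dv|^{n-2} Dv`. Subtracting the two
equations gives `w_t - div A = f` with zero parabolic boundary values. Testing with `w` and dropping
the nonnegative final energy leaves `∬ ⟨A, G⟩ ≤ ∬ |f| |w|`. Strong monotonicity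
(`norm_sub_rpow_le_inner_flux`) bounds the left side from below by `2^{1-n} ∬ |G|^n`.

On almost every time slice `w(·,t)` lies in the borderline Sobolev space `W₀^{1,n}(B)`, hence in an
exponential class, which is dual to `L log L`. Integrability of `exp(|w|/L)` suffices; it comes from
iterating the `W^{1,1}` Sobolev inequality on powers (`lintegral_pow_le_factorial`,
`lintegral_exp_le`). Duality gives `∫ |f| |w(·,t)| ≤ c J ‖G(·,t)‖_n`, where `J = llogl B f` does not
depend on `t`. With `X = ∬ |G|^n` and time interval `I`, Hölder in time yields `X ≤ c J |I|^{1-1/n}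
X^{1/n}`. Since `X` is finite, `X^{1/n}` can be cancelled (`rpow_lintegral_grad_le`). After
averaging over the cylinder `|I|`, and with it `λ`, disappears, and the surplus `|B|^{1/n}` supplies
the factor `r` (`average_rpow_le`).

Testing with `w` needs care because `w` has no time derivative. The equation between `t - d` and `t`
is tested with the frozen slice `w(·,t)`, and `⟨w(t), w(t) - w(t-d)⟩ ≥ (‖w(t)‖² - ‖w(t-d)‖²)/2`
(`energy_increment_le`). Integration in `t` telescopes the energies. Dividing by `d` and letting `d
→ 0` recovers `∬ ⟨A, G⟩` by continuity of translations in `L^p` (`energy_le`). -/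

/-! ### Elementary inequalities and exponents. -/

/-- Young's inequality for the pair `a log a`, `exp b`: it is `1 + y ≤ exp y` at `y = b - log a`,
multiplied by `a`. -/
lemma mul_le_mul_log_add_exp {a b : ℝ} (ha : 0 ≤ a) :
    a * b ≤ a * Real.log (Real.exp 1 + a) + Real.exp b := by
  rcases ha.eq_or_lt with rfl | ha
  · simp [Real.exp_nonneg]
  have h1 : b - Real.log a + 1 ≤ Real.exp (b - Real.log a) := Real.add_one_le_exp _
  rw [Real.exp_sub, Real.exp_log ha, le_div_iff₀ ha] at h1
  have h2 : Real.log a ≤ Real.log (Real.exp 1 + a) :=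
    Real.log_le_log ha (by linarith [Real.exp_pos 1])
  nlinarith [mul_le_mul_of_nonneg_left h2 ha.le]

lemma one_le_log_exp_one_add {a : ℝ} (ha : 0 ≤ a) : 1 ≤ Real.log (Real.exp 1 + a) := by
  rw [Real.le_log_iff_exp_le (by positivity)]
  linarith

lemma holderConjugate_natCast {n : ℕ} (hn : 2 ≤ n) :
    (n : ℝ).HolderConjugate ((n : ℝ) / (n - 1)) :=
  Real.HolderConjugate.conjExponent (by exact_mod_cast hn)

lemma enorm_gradient {n : ℕ} (φ : Space n → ℝ) (x : Space n) :
    ‖gradient φ x‖ₑ = ‖fderiv ℝ φ x‖ₑ := by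
  rw [← toDual_gradient, LinearIsometryEquiv.enorm_map]

lemma continuous_gradient {n : ℕ} {φ : Space n → ℝ} (hφ : ContDiff ℝ 1 φ) :
    Continuous (gradient φ) :=
  (InnerProductSpace.toDual ℝ (Space n)).symm.continuous.comp (hφ.continuous_fderiv one_ne_zero)

lemma eLpNorm_natCast {α F : Type*} [MeasurableSpace α] [NormedAddCommGroup F] {μ : Measure α}
    {n : ℕ} (hn : 2 ≤ n) (g : α → F) :
    eLpNorm g n μ = (∫⁻ x, ‖g x‖ₑ ^ (n : ℝ) ∂μ) ^ (1 / (n : ℝ)) := by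
  rw [eLpNorm_eq_lintegral_rpow_enorm_toReal (by simp; omega) (by simp)]
  simp

/-! ### Borderline Sobolev embedding: factorial moments and exponential integrability. -/

/-- Iterated Gagliardo–Nirenberg–Sobolev inequality: passing from `φ ^ s` to `φ ^ (s + 1)`. -/
lemma lintegral_pow_succ_le {n : ℕ} (hn : 2 ≤ n) {B : Set (Space n)}
    {φ : Space n → ℝ} (hφ : ContDiff ℝ 1 φ) (hc : HasCompactSupport φ) (hs : tsupport φ ⊆ B)
    (s : ℕ) :
    eLpNorm (fun x => φ x ^ (s + 1)) (ENNReal.ofReal ((n : ℝ) / (n - 1))) (volume.restrict B) ≤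
      (lintegralPowLePowLIntegralFDerivConst (volume : Measure (Space n)) ((n : ℝ) / (n - 1)) :
          ℝ≥0∞) ^ (1 / ((n : ℝ) / (n - 1))) *
        ((s + 1 : ℕ) * eLpNorm (gradient φ) n (volume.restrict B)) *
        eLpNorm (fun x => φ x ^ s) (ENNReal.ofReal ((n : ℝ) / (n - 1))) (volume.restrict B) := by
  have hq := holderConjugate_natCast hn
  set q : ℝ := (n : ℝ) / (n - 1) with hqdef
  have hq0 : 0 < q := hq.symm.pos
  have hLp : ∀ g : Space n → ℝ, eLpNorm g (ENNReal.ofReal q) (volume.restrict B) =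
      (∫⁻ x in B, ‖g x‖ₑ ^ q) ^ (1 / q) := by
    intro g
    rw [eLpNorm_eq_lintegral_rpow_enorm_toReal (by simpa using hq0) (by simp),
      ENNReal.toReal_ofReal hq0.le]
  have hψ : ContDiff ℝ 1 (fun x => φ x ^ (s + 1)) := hφ.pow _
  have hψc : HasCompactSupport (fun x => φ x ^ (s + 1)) :=
    hc.comp_left (g := fun y : ℝ => y ^ (s + 1)) (by simp)
  -- The `W^{1,1}` Sobolev inequality for the power `φ^{s+1}`. Its gradient is `(s+1) φ^s ∇φ`, and
  -- Hölder with exponents `n` and `q` brings back the `L^q` norm of `φ^s`, so the estimate can be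
  -- iterated.
  have key := lintegral_pow_le_pow_lintegral_fderiv (volume : Measure (Space n)) hψ hψc
    (p := q) (by rw [finrank_euclideanSpace_fin]; exact hq)
  have hfd : ∀ x, ‖fderiv ℝ (fun x => φ x ^ (s + 1)) x‖ₑ =
      (s + 1 : ℕ) * (‖fderiv ℝ φ x‖ₑ * ‖φ x ^ s‖ₑ) := by
    intro x
    rw [fderiv_fun_pow _ (hφ.differentiable one_ne_zero x), enorm_smul]
    simp only [Nat.add_sub_cancel, nsmul_eq_mul, enorm_mul]
    have : ‖((s + 1 : ℕ) : ℝ)‖ₑ = ((s + 1 : ℕ) : ℝ≥0∞) := by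
      rw [Real.enorm_of_nonneg (by positivity), ENNReal.ofReal_natCast]
    rw [this]; ring
  have hint : ∫⁻ x, ‖fderiv ℝ (fun x => φ x ^ (s + 1)) x‖ₑ ≤
      ((s + 1 : ℕ) * eLpNorm (gradient φ) n (volume.restrict B)) *
        eLpNorm (fun x => φ x ^ s) (ENNReal.ofReal q) (volume.restrict B) := by
    have hfm : Continuous (fderiv ℝ φ) := hφ.continuous_fderiv one_ne_zero
    have h0 : ∫⁻ x, ‖fderiv ℝ (fun x => φ x ^ (s + 1)) x‖ₑ =
        (s + 1 : ℕ) * ∫⁻ x in B, ‖fderiv ℝ φ x‖ₑ * ‖φ x ^ s‖ₑ := by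
      simp_rw [hfd]
      rw [lintegral_const_mul' _ _ (by simp), ← setLIntegral_eq_of_support_subset]
      intro x hx
      apply hs
      apply support_fderiv_subset ℝ
      intro h
      exact hx (by beta_reduce; rw [← enorm_gradient, gradient, h, map_zero, enorm_zero, zero_mul])
    rw [h0, hLp, eLpNorm_natCast hn, mul_assoc]
    simp_rw [enorm_gradient]
    gcongr
    exact ENNReal.lintegral_mul_le_Lp_mul_Lq (volume.restrict B) hq
      (f := fun x => ‖fderiv ℝ φ x‖ₑ) (g := fun x => ‖φ x ^ s‖ₑ)
      hfm.enorm.measurable.aemeasurable ((hφ.continuous.pow s).enorm.measurable.aemeasurable)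
  rw [hLp]
  set K : ℝ≥0∞ := (lintegralPowLePowLIntegralFDerivConst (volume : Measure (Space n)) q : ℝ≥0∞)
  calc (∫⁻ x in B, ‖φ x ^ (s + 1)‖ₑ ^ q) ^ (1 / q)
      ≤ (K * (∫⁻ x, ‖fderiv ℝ (fun x => φ x ^ (s + 1)) x‖ₑ) ^ q) ^ (1 / q) := by
        gcongr
        exact (setLIntegral_le_lintegral _ _).trans key
    _ = K ^ (1 / q) * (∫⁻ x, ‖fderiv ℝ (fun x => φ x ^ (s + 1)) x‖ₑ) := by
        rw [ENNReal.mul_rpow_of_nonneg _ _ (by positivity), ← ENNReal.rpow_mul,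
          mul_one_div_cancel hq0.ne', ENNReal.rpow_one]
    _ ≤ _ := by
        rw [mul_assoc (K ^ (1 / q))]
        gcongr

/-- The constant in the Sobolev-type inequality `lintegral_pow_le_factorial`. -/
noncomputable def sobolevConst (n : ℕ) : ℝ≥0 :=
  (lintegralPowLePowLIntegralFDerivConst (volume : Measure (Space n)) ((n : ℝ) / (n - 1))) ^
    (1 / ((n : ℝ) / (n - 1)))

lemma coe_sobolevConst {n : ℕ} (hn : 2 ≤ n) : (sobolevConst n : ℝ≥0∞) =
    (lintegralPowLePowLIntegralFDerivConst (volume : Measure (Space n)) ((n : ℝ) / (n - 1)) :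
          ℝ≥0∞) ^ (1 / ((n : ℝ) / (n - 1))) := by
  have := (holderConjugate_natCast hn).symm.pos
  rw [sobolevConst, ENNReal.coe_rpow_of_nonneg _ (by positivity)]

/-- Moments of a test function grow at most factorially. -/
lemma lintegral_pow_le_factorial {n : ℕ} (hn : 2 ≤ n) {B : Set (Space n)}
    {φ : Space n → ℝ} (hφ : ContDiff ℝ 1 φ)
    (hc : HasCompactSupport φ) (hs : tsupport φ ⊆ B) (s : ℕ) :
    ∫⁻ x in B, ‖φ x‖ₑ ^ s ≤
      (sobolevConst n * eLpNorm (gradient φ) n (volume.restrict B)) ^ s * s.factorial *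
        volume B := by
  have hq := holderConjugate_natCast hn
  have hq0 : 0 < (n : ℝ) / (n - 1) := hq.symm.pos
  -- The induction runs in `L^{n/(n-1)}`, the space in which the Sobolev step closes. Hölder then
  -- descends to `L¹` and completes the power of `|B|` to the first.
  have hb : ∀ s : ℕ, eLpNorm (fun x => φ x ^ s) (ENNReal.ofReal ((n : ℝ) / (n - 1)))
      (volume.restrict B) ≤
      (sobolevConst n * eLpNorm (gradient φ) n (volume.restrict B)) ^ s * s.factorial *
        volume B ^ (1 / ((n : ℝ) / (n - 1))) := by
    intro s
    induction s with
    | zero =>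
      simp only [pow_zero, Nat.factorial_zero, Nat.cast_one, one_mul]
      rw [eLpNorm_const' _ (by simpa using hq0) (by simp)]
      simp [ENNReal.toReal_ofReal hq0.le]
    | succ s ih =>
      refine (lintegral_pow_succ_le hn hφ hc hs s).trans ?_
      rw [← coe_sobolevConst hn]
      refine (mul_le_mul_right ih _).trans (le_of_eq ?_)
      rw [Nat.factorial_succ]
      push_cast
      ring
  calc ∫⁻ x in B, ‖φ x‖ₑ ^ s = eLpNorm (fun x => φ x ^ s) 1 (volume.restrict B) := by
        rw [eLpNorm_one_eq_lintegral_enorm]; simp [enorm_pow]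
    _ ≤ eLpNorm (fun x => φ x ^ s) (ENNReal.ofReal ((n : ℝ) / (n - 1))) (volume.restrict B) *
          volume B ^ (1 / (n : ℝ)) := by
        have := eLpNorm_le_eLpNorm_mul_rpow_measure_univ (μ := volume.restrict B)
          (f := fun x => φ x ^ s) (p := 1) (q := ENNReal.ofReal ((n : ℝ) / (n - 1)))
          (by rw [ENNReal.one_le_ofReal]; exact hq.symm.lt.le)
          (hφ.continuous.pow s).aestronglyMeasurable
        refine this.trans (le_of_eq ?_)
        rw [ENNReal.toReal_ofReal hq0.le, Measure.restrict_apply_univ]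
        congr 2
        have := hq.inv_add_inv_eq_one
        simp only [ENNReal.toReal_one, one_div] at *
        linarith
    _ ≤ (sobolevConst n * eLpNorm (gradient φ) n (volume.restrict B)) ^ s * s.factorial *
        volume B ^ (1 / ((n : ℝ) / (n - 1))) * volume B ^ (1 / (n : ℝ)) := by
        gcongr; exact hb s
    _ = _ := by
        rw [mul_assoc, ← ENNReal.rpow_add_of_nonneg _ _ (by positivity) (by positivity)]
        have := hq.inv_add_inv_eq_one
        rw [one_div, one_div, add_comm, this, ENNReal.rpow_one]

/-- Exponential integrability of test functions. -/
lemma lintegral_exp_le {n : ℕ} (hn : 2 ≤ n) {B : Set (Space n)}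
    {φ : Space n → ℝ} (hφ : ContDiff ℝ 1 φ)
    (hc : HasCompactSupport φ) (hs : tsupport φ ⊆ B) {L : ℝ} (hL : 0 < L)
    (hL' : 2 * (sobolevConst n * eLpNorm (gradient φ) n (volume.restrict B)) ≤ ENNReal.ofReal L) :
    ∫⁻ x in B, ENNReal.ofReal (Real.exp (|φ x| / L)) ≤ 2 * volume B := by
  have hexp : ∀ x, ENNReal.ofReal (Real.exp (|φ x| / L)) =
      ∑' s : ℕ, ‖φ x‖ₑ ^ s * (((ENNReal.ofReal L) ^ s)⁻¹ * (s.factorial : ℝ≥0∞)⁻¹) := by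
    intro x
    have h1 : HasSum (fun s : ℕ => (|φ x| / L) ^ s / s.factorial) (Real.exp (|φ x| / L)) := by
      rw [Real.exp_eq_exp_ℝ]; exact NormedSpace.expSeries_div_hasSum_exp _
    rw [← h1.tsum_eq, ENNReal.ofReal_tsum_of_nonneg (fun s => by positivity) h1.summable]
    congr 1; ext s
    rw [ENNReal.ofReal_div_of_pos (by positivity), ENNReal.ofReal_pow (by positivity),
      ENNReal.ofReal_div_of_pos hL, ENNReal.ofReal_natCast, ← Real.norm_eq_abs, ofReal_norm,
      ENNReal.div_eq_inv_mul, ENNReal.div_eq_inv_mul, mul_pow, ENNReal.inv_pow]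
    ring
  simp_rw [hexp]
  rw [lintegral_tsum]
  swap
  · intro s
    exact ((hφ.continuous.enorm.measurable.pow_const s).mul_const _).aemeasurable
  set Λ := (sobolevConst n * eLpNorm (gradient φ) n (volume.restrict B)) with hΛ
  have hL0 : ENNReal.ofReal L ≠ 0 := by simpa using hL
  -- The factorial of the moment bound cancels that of the exponential series, and `Λ / L ≤ 1/2`
  -- leaves a geometric series with sum `2`.
  have hterm : ∀ s : ℕ, ∫⁻ x in B, ‖φ x‖ₑ ^ s *
      (((ENNReal.ofReal L) ^ s)⁻¹ * (s.factorial : ℝ≥0∞)⁻¹) ≤ (2⁻¹) ^ s * volume B := by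
    intro s
    rw [lintegral_mul_const _ (hφ.continuous.enorm.measurable.pow_const s)]
    have hf0 : (s.factorial : ℝ≥0∞) ≠ 0 := by simp [Nat.factorial_ne_zero]
    calc _ ≤ (Λ ^ s * s.factorial * volume B) *
          (((ENNReal.ofReal L) ^ s)⁻¹ * (s.factorial : ℝ≥0∞)⁻¹) := by
          gcongr; exact lintegral_pow_le_factorial hn hφ hc hs s
      _ = (Λ * (ENNReal.ofReal L)⁻¹) ^ s * volume B *
          ((s.factorial : ℝ≥0∞) * (s.factorial : ℝ≥0∞)⁻¹) := by
          rw [mul_pow, ENNReal.inv_pow]; ring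
      _ = (Λ * (ENNReal.ofReal L)⁻¹) ^ s * volume B := by
          rw [ENNReal.mul_inv_cancel hf0 (by simp), mul_one]
      _ ≤ _ := by
          gcongr
          rw [← div_eq_mul_inv]
          apply ENNReal.div_le_of_le_mul
          calc Λ = 2⁻¹ * (2 * Λ) := by
                rw [← mul_assoc, ENNReal.inv_mul_cancel (by simp) (by simp), one_mul]
            _ ≤ _ := by gcongr
  refine (ENNReal.tsum_le_tsum hterm).trans ?_
  rw [ENNReal.tsum_mul_right, ENNReal.tsum_geometric, ENNReal.one_sub_inv_two, inv_inv]

/-! ### Duality between `L log L` and the exponential class, up to zero-trace functions. -/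

/-- The `L log L` modular of `f` on `B`, normalised by the mean of `|f|`. -/
noncomputable def llogl {n : ℕ} (B : Set (Space n)) (f : Space n → ℝ) : ℝ≥0∞ :=
  ∫⁻ x in B, ENNReal.ofReal (|f x| * Real.log (Real.exp 1 + |f x| / ⨍ y in B, |f y|))

lemma average_abs_nonneg {n : ℕ} (B : Set (Space n)) (f : Space n → ℝ) :
    0 ≤ ⨍ y in B, |f y| := by
  rw [setAverage_eq]
  exact smul_nonneg (by positivity) (integral_nonneg fun _ => abs_nonneg _)

lemma lintegral_enorm_le_llogl {n : ℕ} (B : Set (Space n)) (f : Space n → ℝ) :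
    ∫⁻ x in B, ‖f x‖ₑ ≤ llogl B f := by
  refine lintegral_mono fun x => ?_
  rw [← ofReal_norm, Real.norm_eq_abs]
  apply ENNReal.ofReal_le_ofReal
  exact le_mul_of_one_le_right (abs_nonneg _)
    (one_le_log_exp_one_add (div_nonneg (abs_nonneg _) (average_abs_nonneg B f)))

/-- Orlicz duality between `L log L` and the exponential class, for test functions. -/
lemma lintegral_mul_le_of_contDiff {n : ℕ} (hn : 2 ≤ n) {B : Set (Space n)}
    (hvol : volume B ≠ ⊤) {f : Space n → ℝ} (hf : IntegrableOn f B) (hfin : llogl B f ≠ ⊤)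
    {φ : Space n → ℝ} (hφ : ContDiff ℝ 1 φ) (hc : HasCompactSupport φ) (hs : tsupport φ ⊆ B) :
    ∫⁻ x in B, ‖f x‖ₑ * ‖φ x‖ₑ ≤
      6 * sobolevConst n * llogl B f * eLpNorm (gradient φ) n (volume.restrict B) := by
  set m : ℝ := ⨍ y in B, |f y| with hm
  have hm0 : 0 ≤ m := average_abs_nonneg B f
  have hmB : ENNReal.ofReal m * volume B = ∫⁻ x in B, ‖f x‖ₑ := by
    rcases eq_or_ne (volume B) 0 with h0 | h0
    · simp [Measure.restrict_zero_set h0, h0]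
    rw [hm, setAverage_eq, smul_eq_mul, ENNReal.ofReal_mul (by positivity),
      ofReal_integral_eq_lintegral_ofReal hf.abs (ae_of_all _ fun _ => abs_nonneg _)]
    rw [Measure.real, ← ENNReal.toReal_inv, ENNReal.ofReal_toReal (by simpa using h0), mul_comm,
      ← mul_assoc, ENNReal.mul_inv_cancel h0 hvol, one_mul]
    simp_rw [← Real.norm_eq_abs, ofReal_norm]
  -- A vanishing mean forces `f = 0` almost everywhere, so division by `m` is legitimate in the
  -- remaining case.
  rcases hm0.eq_or_lt with hm1 | hm1
  · have : ∫⁻ x in B, ‖f x‖ₑ = 0 := by rw [← hmB, ← hm1]; simp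
    have hz : (fun x => ‖f x‖ₑ) =ᵐ[volume.restrict B] 0 :=
      (lintegral_eq_zero_iff' hf.aestronglyMeasurable.enorm).1 this
    have : ∫⁻ x in B, ‖f x‖ₑ * ‖φ x‖ₑ = 0 := by
      rw [← lintegral_zero (μ := volume.restrict B)]
      apply lintegral_congr_ae
      filter_upwards [hz] with x hx
      simp at hx
      simp [hx]
    rw [this]; exact zero_le
  have hΛfin : eLpNorm (gradient φ) n (volume.restrict B) ≠ ⊤ := by
    have h1 : HasCompactSupport (gradient φ) :=
      (hc.fderiv ℝ).comp_left (g := (InnerProductSpace.toDual ℝ (Space n)).symm) (by simp)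
    exact (((continuous_gradient hφ).memLp_of_hasCompactSupport h1).restrict B).eLpNorm_ne_top
  set N := eLpNorm (gradient φ) n (volume.restrict B) with hN
  -- Young's inequality with `a = |f|/m`, `b = |φ|/L`, multiplied by `L m`. The exponential term
  -- contributes at most `2 L m |B| = 2 L ∫ |f|`, again bounded by the modular, whence the total
  -- factor `3`.
  have main : ∀ L : ℝ, 0 < L → 2 * (sobolevConst n * N) ≤ ENNReal.ofReal L →
      ∫⁻ x in B, ‖f x‖ₑ * ‖φ x‖ₑ ≤ 3 * ENNReal.ofReal L * llogl B f := by
    intro L hL hL'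
    have hpt : ∀ x, ‖f x‖ₑ * ‖φ x‖ₑ ≤ ENNReal.ofReal L *
        ENNReal.ofReal (|f x| * Real.log (Real.exp 1 + |f x| / m)) +
        ENNReal.ofReal L * ENNReal.ofReal m * ENNReal.ofReal (Real.exp (|φ x| / L)) := by
      intro x
      have hlog := one_le_log_exp_one_add (div_nonneg (abs_nonneg (f x)) hm1.le)
      rw [← ofReal_norm, ← ofReal_norm, ← ENNReal.ofReal_mul (by positivity),
        ← ENNReal.ofReal_mul (by positivity), ← ENNReal.ofReal_mul (by positivity),
        ← ENNReal.ofReal_mul (by positivity),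
        ← ENNReal.ofReal_add (by positivity) (by positivity)]
      apply ENNReal.ofReal_le_ofReal
      have := mul_le_mul_log_add_exp (a := |f x| / m) (b := |φ x| / L) (by positivity)
      have h2 := mul_le_mul_of_nonneg_left this (mul_pos hL hm1).le
      rw [Real.norm_eq_abs, Real.norm_eq_abs]
      calc |f x| * |φ x| = L * m * (|f x| / m * (|φ x| / L)) := by field_simp
        _ ≤ _ := h2
        _ = _ := by field_simp
    have hmeas : AEMeasurable (fun x => ENNReal.ofReal (|f x| *
        Real.log (Real.exp 1 + |f x| / m))) (volume.restrict B) := by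
      have := hf.aestronglyMeasurable.aemeasurable
      have h1 : AEMeasurable (fun x => |f x|) (volume.restrict B) := this.abs
      exact (h1.mul ((h1.div_const m).const_add _).log).ennreal_ofReal
    calc ∫⁻ x in B, ‖f x‖ₑ * ‖φ x‖ₑ ≤ _ := lintegral_mono hpt
      _ = ENNReal.ofReal L * llogl B f + ENNReal.ofReal L * ENNReal.ofReal m *
          ∫⁻ x in B, ENNReal.ofReal (Real.exp (|φ x| / L)) := by
          rw [lintegral_add_left' (hmeas.const_mul _), lintegral_const_mul'' _ hmeas,
            lintegral_const_mul' _ _ (by finiteness)]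
          rfl
      _ ≤ ENNReal.ofReal L * llogl B f + ENNReal.ofReal L * ENNReal.ofReal m *
          (2 * volume B) := by
          gcongr; exact lintegral_exp_le hn hφ hc hs hL hL'
      _ = ENNReal.ofReal L * llogl B f + 2 * ENNReal.ofReal L * (ENNReal.ofReal m *
          volume B) := by ring
      _ ≤ ENNReal.ofReal L * llogl B f + 2 * ENNReal.ofReal L * llogl B f := by
          rw [hmB]; gcongr; exact lintegral_enorm_le_llogl B f
      _ = _ := by ring
  have hΛ : 2 * (sobolevConst n * N) ≠ ⊤ := by finiteness
  -- The optimal `L = 2 c N` may be zero, so it is approached from above by `2 c N + 1/(k+1)`; then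
  -- `3 · 2 = 6` is the final constant.
  have hlim : Tendsto (fun k : ℕ => 3 * (2 * (sobolevConst n * N) +
      ENNReal.ofReal (1 / ((k : ℝ) + 1))) * llogl B f) atTop
      (𝓝 (3 * (2 * (sobolevConst n * N) + ENNReal.ofReal 0) * llogl B f)) := by
    refine ENNReal.Tendsto.mul_const ?_ (Or.inr hfin)
    refine ENNReal.Tendsto.const_mul ?_ (Or.inr (by simp))
    exact tendsto_const_nhds.add
      (ENNReal.tendsto_ofReal tendsto_one_div_add_atTop_nhds_zero_nat)
  refine (ge_of_tendsto' hlim fun k => ?_).trans (le_of_eq ?_)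
  · have hk : (0 : ℝ) < 1 / ((k : ℝ) + 1) := by positivity
    have e : 2 * (sobolevConst n * N) + ENNReal.ofReal (1 / ((k : ℝ) + 1)) =
        ENNReal.ofReal ((2 * (sobolevConst n * N)).toReal + 1 / ((k : ℝ) + 1)) := by
      rw [ENNReal.ofReal_add (by positivity) hk.le, ENNReal.ofReal_toReal hΛ]
    rw [e]
    apply main _ (by positivity)
    rw [← e]; exact le_self_add
  · simp; ring

/-- Gradients of differences of test functions. -/
lemma gradient_sub' {n : ℕ} {φ ψ : Space n → ℝ} (hφ : ContDiff ℝ 1 φ) (hψ : ContDiff ℝ 1 ψ) :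
    gradient (fun x => φ x - ψ x) = fun x => gradient φ x - gradient ψ x := by
  ext1 x
  simp only [gradient]
  rw [fderiv_fun_sub (hφ.differentiable one_ne_zero x) (hψ.differentiable one_ne_zero x), map_sub]

/-- Orlicz duality for functions with zero trace, relative to a test function `ψ`. -/
lemma HasZeroTrace.lintegral_mul_sub_le {n : ℕ} (hn : 2 ≤ n) {B : Set (Space n)}
    (hvol : volume B ≠ ⊤) {f : Space n → ℝ} (hf : IntegrableOn f B) (hfin : llogl B f ≠ ⊤)
    {w : Space n → ℝ} {G : Space n → Space n}
    (hw : AEStronglyMeasurable w (volume.restrict B))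
    (hG : AEStronglyMeasurable G (volume.restrict B))
    (h : HasZeroTrace n B w G)
    {ψ : Space n → ℝ} (hψ : ContDiff ℝ 1 ψ) (hc : HasCompactSupport ψ) (hs : tsupport ψ ⊆ B) :
    ∫⁻ x in B, ‖f x‖ₑ * ‖w x - ψ x‖ₑ ≤
      6 * sobolevConst n * llogl B f *
        eLpNorm (fun x => G x - gradient ψ x) n (volume.restrict B) := by
  obtain ⟨φ, hφ, hφw, hφG⟩ := h
  have hφ1 : ∀ k, ContDiff ℝ 1 (φ k) := fun k => (hφ k).1.of_le (by exact_mod_cast le_top)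
  have hn1 : (1 : ℝ≥0∞) ≤ n := by exact_mod_cast (by omega : 1 ≤ n)
  set K := 6 * sobolevConst n * llogl B f with hK
  have hKfin : K ≠ ⊤ := by finiteness
  have hmeas := tendstoInMeasure_of_tendsto_eLpNorm (p := (n : ℝ≥0∞)) (by positivity)
    (fun k => (hφ1 k).continuous.aestronglyMeasurable) hw hφw
  obtain ⟨ns, hns, hae⟩ := hmeas.exists_seq_tendsto_ae
  set N := eLpNorm (fun x => G x - gradient ψ x) n (volume.restrict B)
  have hgm : ∀ k, AEStronglyMeasurable (gradient (φ k)) (volume.restrict B) := fun k =>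
    (continuous_gradient (hφ1 k)).aestronglyMeasurable
  have hstep : ∀ k, ∫⁻ x in B, ‖f x‖ₑ * ‖φ k x - ψ x‖ₑ ≤
      K * (eLpNorm (fun x => gradient (φ k) x - G x) n (volume.restrict B) + N) := by
    intro k
    refine (lintegral_mul_le_of_contDiff hn hvol hf hfin ((hφ1 k).sub hψ)
      ((hφ k).2.1.sub hc) ((tsupport_sub _ _).trans (union_subset (hφ k).2.2 hs))).trans ?_
    rw [gradient_sub' (hφ1 k) hψ]
    gcongr
    refine le_trans (le_of_eq ?_) (eLpNorm_add_le ((hgm k).sub hG)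
      (hG.sub (continuous_gradient hψ).aestronglyMeasurable) hn1)
    congr 1; ext1 x; simp
  have hlim : Tendsto (fun k => K * (eLpNorm (fun x => gradient (φ (ns k)) x - G x) n
      (volume.restrict B) + N)) atTop (𝓝 (K * (0 + N))) :=
    ENNReal.Tendsto.const_mul
      ((hφG.comp hns.tendsto_atTop).add tendsto_const_nhds) (Or.inr hKfin)
  -- As `f` is only in `L log L`, convergence of `φ k` in `L^n` does not control the products.
  -- Fatou's lemma along an almost everywhere convergent subsequence is enough for an upper bound.
  calc ∫⁻ x in B, ‖f x‖ₑ * ‖w x - ψ x‖ₑ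
      = ∫⁻ x in B, liminf (fun k => ‖f x‖ₑ * ‖φ (ns k) x - ψ x‖ₑ) atTop := by
        apply lintegral_congr_ae
        filter_upwards [hae] with x hx
        refine (Tendsto.liminf_eq ?_).symm
        exact ENNReal.Tendsto.const_mul (((hx.sub_const _)).enorm) (Or.inr (by finiteness))
    _ ≤ liminf (fun k => ∫⁻ x in B, ‖f x‖ₑ * ‖φ (ns k) x - ψ x‖ₑ) atTop :=
        lintegral_liminf_le' fun k => hf.aestronglyMeasurable.enorm.mul
          (((hφ1 _).continuous.sub hψ.continuous).aestronglyMeasurable.enorm)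
    _ ≤ liminf (fun k => K * (eLpNorm (fun x => gradient (φ (ns k)) x - G x) n
          (volume.restrict B) + N)) atTop :=
        liminf_le_liminf (Eventually.of_forall fun k => hstep _)
    _ = _ := by rw [hlim.liminf_eq, zero_add]

lemma HasZeroTrace.lintegral_mul_le {n : ℕ} (hn : 2 ≤ n) {B : Set (Space n)}
    (hvol : volume B ≠ ⊤) {f : Space n → ℝ} (hf : IntegrableOn f B) (hfin : llogl B f ≠ ⊤)
    {w : Space n → ℝ} {G : Space n → Space n}
    (hw : AEStronglyMeasurable w (volume.restrict B))
    (hG : AEStronglyMeasurable G (volume.restrict B))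
    (h : HasZeroTrace n B w G) :
    ∫⁻ x in B, ‖f x‖ₑ * ‖w x‖ₑ ≤
      6 * sobolevConst n * llogl B f * eLpNorm G n (volume.restrict B) := by
  have := h.lintegral_mul_sub_le hn hvol hf hfin hw hG (ψ := fun _ => 0) contDiff_const
    (by simp [HasCompactSupport, tsupport]) (by simp [tsupport])
  simpa [gradient] using this

/-! ### Smoothed Heaviside functions and weak time derivatives. -/

/-- The normalised bump on the real line of radius `δ` centred at `c`. -/
noncomputable def bumpAt (c δ : ℝ) (hδ : 0 < δ) : ℝ → ℝ :=
  (ContDiffBump.mk (c := c) (δ / 2) δ (by linarith) (by linarith)).normed volume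

section bump
variable {c δ : ℝ} (hδ : 0 < δ)

lemma bumpAt_nonneg (x : ℝ) : 0 ≤ bumpAt c δ hδ x := ContDiffBump.nonneg_normed _ _

lemma bumpAt_continuous : Continuous (bumpAt c δ hδ) := ContDiffBump.continuous_normed _

lemma bumpAt_integral : ∫ x, bumpAt c δ hδ x = 1 := ContDiffBump.integral_normed _

lemma bumpAt_integrable : Integrable (bumpAt c δ hδ) := ContDiffBump.integrable_normed _

lemma bumpAt_support : Function.support (bumpAt c δ hδ) = Metric.ball c δ :=
  ContDiffBump.support_normed_eq _

/-- The primitive of `bumpAt`, a smoothed Heaviside function. -/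
noncomputable def stepAt (c δ : ℝ) (hδ : 0 < δ) (x : ℝ) : ℝ := ∫ y in Iic x, bumpAt c δ hδ y

lemma stepAt_nonneg (x : ℝ) : 0 ≤ stepAt c δ hδ x :=
  integral_nonneg fun _ => bumpAt_nonneg hδ _

lemma stepAt_le_one (x : ℝ) : stepAt c δ hδ x ≤ 1 := by
  rw [← bumpAt_integral (c := c) hδ]
  exact setIntegral_le_integral (bumpAt_integrable hδ) (ae_of_all _ (bumpAt_nonneg hδ))

lemma stepAt_eq_zero {x : ℝ} (hx : x ≤ c - δ) : stepAt c δ hδ x = 0 := by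
  apply setIntegral_eq_zero_of_forall_eq_zero
  intro y hy
  by_contra h
  have : y ∈ Metric.ball c δ := by rw [← bumpAt_support hδ]; exact h
  rw [Real.ball_eq_Ioo] at this
  have := mem_Iic.1 hy
  linarith [‹y ∈ Ioo _ _›.1]

lemma stepAt_eq_one {x : ℝ} (hx : c + δ ≤ x) : stepAt c δ hδ x = 1 := by
  rw [← bumpAt_integral (c := c) hδ]
  apply setIntegral_eq_integral_of_forall_compl_eq_zero
  intro y hy
  by_contra h
  have : y ∈ Metric.ball c δ := by rw [← bumpAt_support hδ]; exact h
  rw [Real.ball_eq_Ioo] at this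
  have := not_le.1 (mem_Iic.not.1 hy)
  linarith [‹y ∈ Ioo _ _›.2]

lemma stepAt_hasDerivAt (x : ℝ) : HasDerivAt (stepAt c δ hδ) (bumpAt c δ hδ x) x := by
  have h : ∀ y, stepAt c δ hδ y = stepAt c δ hδ 0 + ∫ z in (0 : ℝ)..y, bumpAt c δ hδ z := by
    intro y
    rw [← intervalIntegral.integral_Iic_sub_Iic (bumpAt_integrable hδ).integrableOn
      (bumpAt_integrable hδ).integrableOn]
    simp [stepAt]
  rw [funext h]
  exact ((bumpAt_continuous hδ).integral_hasStrictDerivAt 0 x).hasDerivAt.const_add _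

lemma stepAt_contDiff : ContDiff ℝ 1 (stepAt c δ hδ) := by
  rw [contDiff_one_iff_deriv]
  refine ⟨fun x => (stepAt_hasDerivAt hδ x).differentiableAt, ?_⟩
  have h : deriv (stepAt c δ hδ) = bumpAt c δ hδ :=
    funext fun x => (stepAt_hasDerivAt hδ x).deriv
  rw [h]
  exact bumpAt_continuous hδ

lemma abs_setIntegral_mul_bumpAt_sub_le {I : Set ℝ} (hI : MeasurableSet I) {g : ℝ → ℝ}
    (hg : ContinuousOn g I) {ε : ℝ} (hδI : Metric.closedBall c δ ⊆ I)
    (hε : ∀ x ∈ Metric.ball c δ, |g x - g c| ≤ ε) :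
    |(∫ x in I, g x * bumpAt c δ hδ x) - g c| ≤ ε := by
  have hsup : Function.support (bumpAt c δ hδ) ⊆ Metric.closedBall c δ := by
    rw [bumpAt_support]; exact Metric.ball_subset_closedBall
  have h0 : (∫ x in I, g x * bumpAt c δ hδ x) =
      ∫ x in Metric.closedBall c δ, g x * bumpAt c δ hδ x := by
    apply setIntegral_eq_of_subset_of_forall_sdiff_eq_zero hI hδI
    intro x hx
    have : x ∉ Function.support (bumpAt c δ hδ) := fun h => hx.2 (hsup h)
    rw [Function.notMem_support.1 this, mul_zero]
  have h1 : (∫ x in Metric.closedBall c δ, bumpAt c δ hδ x) = 1 := by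
    rw [setIntegral_eq_integral_of_forall_compl_eq_zero, bumpAt_integral]
    intro x hx
    exact Function.notMem_support.1 fun h => hx (hsup h)
  have hint : IntegrableOn (fun x => g x * bumpAt c δ hδ x) (Metric.closedBall c δ) :=
    ((hg.mono hδI).mul (bumpAt_continuous hδ).continuousOn).integrableOn_compact
      (isCompact_closedBall c δ)
  have hint1 : IntegrableOn (fun x => g c * bumpAt c δ hδ x) (Metric.closedBall c δ) :=
    ((bumpAt_integrable hδ).const_mul _).integrableOn
  have h2 : (∫ x in I, g x * bumpAt c δ hδ x) - g c =
      ∫ x in Metric.closedBall c δ, (g x - g c) * bumpAt c δ hδ x := by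
    simp_rw [sub_mul]
    rw [integral_sub hint hint1, integral_const_mul, h1, h0, mul_one]
  rw [h2, ← Real.norm_eq_abs]
  calc _ ≤ ∫ x in Metric.closedBall c δ, ε * bumpAt c δ hδ x := by
        apply norm_integral_le_of_norm_le ((bumpAt_integrable hδ).const_mul _).integrableOn
        refine ae_of_all _ fun x => ?_
        by_cases hx : x ∈ Metric.ball c δ
        · rw [norm_mul, Real.norm_eq_abs, Real.norm_eq_abs, abs_of_nonneg (bumpAt_nonneg hδ x)]
          exact mul_le_mul_of_nonneg_right (hε x hx) (bumpAt_nonneg hδ x)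
        · rw [← bumpAt_support hδ, Function.notMem_support] at hx
          simp [hx]
    _ = ε := by rw [integral_const_mul, h1, mul_one]

end bump

lemma tendsto_setIntegral_mul_bumpAt {I : Set ℝ} (hI : IsOpen I) {g : ℝ → ℝ}
    (hg : ContinuousOn g I) {c : ℝ} (hc : c ∈ I) {δ : ℕ → ℝ} (hδ : ∀ k, 0 < δ k)
    (hδ0 : Tendsto δ atTop (𝓝 0)) :
    Tendsto (fun k => ∫ x in I, g x * bumpAt c (δ k) (hδ k) x) atTop (𝓝 (g c)) := by
  rw [Metric.tendsto_atTop']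
  intro ε hε
  have h1 : ∀ᶠ x in 𝓝 c, x ∈ I ∧ |g x - g c| ≤ ε / 2 := by
    have h2 := (hg.continuousAt (hI.mem_nhds hc)).eventually (Metric.closedBall_mem_nhds _
      (half_pos hε))
    filter_upwards [h2, hI.mem_nhds hc] with x hx hxI
    exact ⟨hxI, by simpa [Real.dist_eq] using hx⟩
  obtain ⟨d, hd, hdI⟩ := Metric.eventually_nhds_iff_ball.1 h1
  obtain ⟨N, hN⟩ := eventually_atTop.1 (hδ0.eventually (gt_mem_nhds hd))
  refine ⟨N, fun k hk => ?_⟩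
  have hsub : Metric.closedBall c (δ k) ⊆ Metric.ball c d :=
    Metric.closedBall_subset_ball (hN k hk.le)
  rw [Real.dist_eq]
  refine (abs_setIntegral_mul_bumpAt_sub_le (hδ k) hI.measurableSet hg
    (fun x hx => (hdI x (hsub hx)).1)
    (fun x hx => (hdI x (hsub (Metric.ball_subset_closedBall hx))).2)).trans_lt (half_lt_self hε)

/-- A continuous function on `(a,b)` with integrable distributional derivative is a primitive
of it. -/
lemma sub_eq_setIntegral_of_weak_deriv {a b : ℝ} {g β : ℝ → ℝ} (hg : ContinuousOn g (Ioo a b))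
    (hβ : IntegrableOn β (Ioo a b))
    (h : ∀ η : ℝ → ℝ, ContDiff ℝ 1 η → HasCompactSupport η → tsupport η ⊆ Ioo a b →
      ∫ x in Ioo a b, g x * deriv η x = - ∫ x in Ioo a b, β x * η x)
    {s t : ℝ} (hs : s ∈ Ioo a b) (ht : t ∈ Ioo a b) (hst : s < t) :
    g t - g s = ∫ x in Ioo s t, β x := by
  set d := min (min (s - a) (b - t)) (t - s) with hd
  have hd0 : 0 < d := by
    simp only [hd, lt_min_iff, sub_pos]; exact ⟨⟨hs.1, ht.2⟩, hst⟩
  have hd1 : d ≤ s - a := (min_le_left _ _).trans (min_le_left _ _)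
  have hd2 : d ≤ b - t := (min_le_left _ _).trans (min_le_right _ _)
  set δ : ℕ → ℝ := fun k => d / 2 * (1 / ((k : ℝ) + 1)) with hδdef
  have hδ : ∀ k, 0 < δ k := fun k => by positivity
  have hδd : ∀ k, δ k < d := fun k => by
    have : 1 / ((k : ℝ) + 1) ≤ 1 := by
      rw [div_le_one (by positivity)]; linarith [k.cast_nonneg (α := ℝ)]
    have := mul_le_mul_of_nonneg_left this (half_pos hd0).le
    simp only [hδdef]; linarith
  have hδ0 : Tendsto δ atTop (𝓝 0) := by
    simpa [hδdef] using (tendsto_one_div_add_atTop_nhds_zero_nat (𝕜 := ℝ)).const_mul (d / 2)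
  -- A smooth plateau tending to the indicator of `(s,t)`. Its derivative is a bump at `s` minus a
  -- bump at `t`, so `∫ g η'` tends to `g s - g t`.
  set η : ℕ → ℝ → ℝ := fun k x => stepAt s (δ k) (hδ k) x - stepAt t (δ k) (hδ k) x with hη
  have hηsupp : ∀ k, tsupport (η k) ⊆ Icc (s - δ k) (t + δ k) := by
    intro k
    apply closure_minimal _ isClosed_Icc
    intro x hx
    by_contra hx'
    apply hx
    simp only [mem_Icc, not_and_or, not_le] at hx'
    have := hδ k
    rcases hx' with hx' | hx'
    · simp [hη, stepAt_eq_zero (hδ k) hx'.le,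
        stepAt_eq_zero (c := t) (hδ k) (x := x) (by linarith)]
    · simp [hη, stepAt_eq_one (hδ k) hx'.le,
        stepAt_eq_one (c := s) (hδ k) (x := x) (by linarith)]
  have hIcc : ∀ k, Icc (s - δ k) (t + δ k) ⊆ Ioo a b := fun k x hx => by
    have := hδd k
    exact ⟨by linarith [hx.1], by linarith [hx.2]⟩
  have hk : ∀ k, (∫ x in Ioo a b, g x * bumpAt s (δ k) (hδ k) x) -
      (∫ x in Ioo a b, g x * bumpAt t (δ k) (hδ k) x) = - ∫ x in Ioo a b, β x * η k x := by
    intro k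
    have hbump : ∀ c, Metric.closedBall c (δ k) ⊆ Ioo a b →
        IntegrableOn (fun x => g x * bumpAt c (δ k) (hδ k) x) (Ioo a b) := by
      intro c hc
      refine IntegrableOn.of_forall_sdiff_eq_zero (s := Metric.closedBall c (δ k))
        (((hg.mono hc).mul (bumpAt_continuous (hδ k)).continuousOn).integrableOn_compact
        (isCompact_closedBall c _)) measurableSet_Ioo ?_
      intro x hx
      have : x ∉ Function.support (bumpAt c (δ k) (hδ k)) := by
        rw [bumpAt_support]; exact fun h => hx.2 (Metric.ball_subset_closedBall h)
      rw [Function.notMem_support.1 this, mul_zero]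
    have hb1 : Metric.closedBall s (δ k) ⊆ Ioo a b := by
      rw [Real.closedBall_eq_Icc]
      exact (Icc_subset_Icc le_rfl (by linarith)).trans (hIcc k)
    have hb2 : Metric.closedBall t (δ k) ⊆ Ioo a b := by
      rw [Real.closedBall_eq_Icc]
      exact (Icc_subset_Icc (by linarith) le_rfl).trans (hIcc k)
    rw [← h (η k) ((stepAt_contDiff (hδ k)).sub (stepAt_contDiff (hδ k)))
      (HasCompactSupport.of_support_subset_isCompact isCompact_Icc
        ((subset_tsupport _).trans (hηsupp k))) ((hηsupp k).trans (hIcc k)),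
      ← integral_sub (hbump s hb1) (hbump t hb2)]
    congr 1
    ext1 x
    have hd : HasDerivAt (η k) _ x :=
      (stepAt_hasDerivAt (hδ k) x).sub (stepAt_hasDerivAt (hδ k) x)
    rw [hd.deriv, mul_sub]
  have hl1 := (tendsto_setIntegral_mul_bumpAt isOpen_Ioo hg hs hδ hδ0).sub
    (tendsto_setIntegral_mul_bumpAt isOpen_Ioo hg ht hδ hδ0)
  have hl2 : Tendsto (fun k => ∫ x in Ioo a b, β x * η k x) atTop
      (𝓝 (∫ x in Ioo a b, β x * (Ioo s t).indicator 1 x)) := by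
    apply tendsto_integral_of_dominated_convergence (fun x => |β x|)
    · exact fun k => hβ.aestronglyMeasurable.mul (((stepAt_contDiff (hδ k)).sub
        (stepAt_contDiff (hδ k))).continuous.aestronglyMeasurable)
    · exact hβ.abs
    · intro k
      refine ae_of_all _ fun x => ?_
      rw [norm_mul, Real.norm_eq_abs]
      refine mul_le_of_le_one_right (abs_nonneg _) ?_
      rw [Real.norm_eq_abs, abs_le]
      have h1 := stepAt_nonneg (c := s) (hδ k) x
      have h2 := stepAt_nonneg (c := t) (hδ k) x
      have h3 := stepAt_le_one (c := s) (hδ k) x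
      have h4 := stepAt_le_one (c := t) (hδ k) x
      constructor <;> simp only [hη] <;> linarith
    · have hne : ∀ᵐ x ∂(volume.restrict (Ioo a b)), x ≠ s ∧ x ≠ t := by
        apply ae_restrict_of_ae
        filter_upwards [Measure.ae_ne volume s, Measure.ae_ne volume t] with x h1 h2
        exact ⟨h1, h2⟩
      filter_upwards [hne] with x hx
      apply Tendsto.const_mul
      apply tendsto_const_nhds.congr'
      rcases lt_or_gt_of_ne hx.1 with h1 | h1
      · filter_upwards [hδ0.eventually (gt_mem_nhds (sub_pos.2 h1))] with k hk
        simp only [hη]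
        rw [stepAt_eq_zero, stepAt_eq_zero, indicator_of_notMem]
        · simp
        · exact fun h => absurd h.1 (by linarith)
        · linarith
        · linarith
      · rcases lt_or_gt_of_ne hx.2 with h2 | h2
        · filter_upwards [hδ0.eventually (gt_mem_nhds (sub_pos.2 h1)),
            hδ0.eventually (gt_mem_nhds (sub_pos.2 h2))] with k hk hk'
          simp only [hη]
          rw [stepAt_eq_one, stepAt_eq_zero, indicator_of_mem (show x ∈ Ioo s t from ⟨h1, h2⟩)]
          · simp
          · linarith
          · linarith
        · filter_upwards [hδ0.eventually (gt_mem_nhds (sub_pos.2 h2))] with k hk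
          simp only [hη]
          rw [stepAt_eq_one, stepAt_eq_one, indicator_of_notMem]
          · simp
          · exact fun h => absurd h.2 (by linarith)
          · linarith
          · linarith
  simp_rw [hk] at hl1
  have hu := tendsto_nhds_unique hl1 hl2.neg
  have hind : (∫ x in Ioo a b, β x * (Ioo s t).indicator 1 x) = ∫ x in Ioo s t, β x := by
    have : (fun x => β x * (Ioo s t).indicator 1 x) = (Ioo s t).indicator β := by
      ext x; by_cases hx : x ∈ Ioo s t <;> simp [hx]
    rw [this, setIntegral_indicator measurableSet_Ioo, inter_eq_self_of_subset_right
      (Ioo_subset_Ioo hs.1.le ht.2.le)]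
  rw [hind] at hu
  linarith

/-! ### The problem solved by the difference, and its curve in `L²`. -/

/-- The conjugate exponent `n / (n - 1)` as an extended nonnegative real. -/
noncomputable def conjExp (n : ℕ) : ℝ≥0∞ := ENNReal.ofReal ((n : ℝ) / (n - 1))

lemma holderTriple_conjExp {n : ℕ} (hn : 2 ≤ n) : ENNReal.HolderTriple (conjExp n) n 1 := by
  have h := holderConjugate_natCast hn
  refine ⟨?_⟩
  have h2 : (n : ℝ≥0∞) = ENNReal.ofReal n := by simp
  rw [conjExp, h2, ← ENNReal.ofReal_inv_of_pos h.symm.pos, ← ENNReal.ofReal_inv_of_pos h.pos,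
    ← ENNReal.ofReal_add (by have := h.symm.pos; positivity) (by positivity), add_comm,
    h.inv_add_inv_eq_one]
  simp

lemma one_le_conjExp {n : ℕ} (hn : 2 ≤ n) : 1 ≤ conjExp n := by
  rw [conjExp, ENNReal.one_le_ofReal]
  exact (holderConjugate_natCast hn).symm.lt.le

/-- A weak formulation, on the cylinder `B × (a,b)`, of `w_t - div A = f` for a function `w` with
zero parabolic boundary values, `G` being the spatial gradient of `w`. -/
structure IsZeroBoundarySolution {n : ℕ} (B : Set (Space n)) (a b : ℝ) (f : Space n → ℝ)
    (w : Space n → ℝ → ℝ) (A G : Space n × ℝ → Space n) : Prop where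
  measurableSet : MeasurableSet B
  volume_ne_top : volume B ≠ ⊤
  integrableOn : IntegrableOn f B
  llogl_ne_top : llogl B f ≠ ⊤
  continuousInL2 : ContinuousInL2 B a b w
  memLp : MemLp (fun z : Space n × ℝ => w z.1 z.2) n (volume.restrict (B ×ˢ Ioo a b))
  stronglyMeasurable_flux : StronglyMeasurable A
  stronglyMeasurable_grad : StronglyMeasurable G
  memLp_flux : MemLp A (conjExp n) (volume.restrict (B ×ˢ Ioo a b))
  memLp_grad : MemLp G n (volume.restrict (B ×ˢ Ioo a b))
  trace : ∀ᵐ t ∂(volume.restrict (Ioo a b)),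
    HasZeroTrace n B (fun x => w x t) (fun x => G (x, t))
  initial : Tendsto (fun t => eLpNorm (fun x => w x t) 2 (volume.restrict B)) (𝓝[>] a) (𝓝 0)
  equation : ∀ (φ : Space n → ℝ) (η : ℝ → ℝ), ContDiff ℝ 1 φ → HasCompactSupport φ →
    tsupport φ ⊆ B → ContDiff ℝ 1 η → HasCompactSupport η → tsupport η ⊆ Ioo a b →
      ∫ z in B ×ˢ Ioo a b, f z.1 * (φ z.1 * η z.2) =
        - (∫ z in B ×ˢ Ioo a b, w z.1 z.2 * (φ z.1 * deriv η z.2)) +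
          ∫ z in B ×ˢ Ioo a b, η z.2 * inner ℝ (gradient φ z.1) (A z)

lemma restrict_prod_eq {n : ℕ} (B : Set (Space n)) (I : Set ℝ) :
    (volume : Measure (Space n × ℝ)).restrict (B ×ˢ I) =
      (volume.restrict B).prod (volume.restrict I) := by
  rw [Measure.volume_eq_prod, Measure.prod_restrict]

open Classical in
/-- The curve `t ↦ w(·,t)` in `L²(B)`, extended by zero outside `(a,b)`. -/
noncomputable def l2Curve {n : ℕ} {B : Set (Space n)} {a b : ℝ} {w : Space n → ℝ → ℝ}
    (h : ContinuousInL2 B a b w) (t : ℝ) : Lp ℝ 2 (volume.restrict B) :=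
  if ht : t ∈ Ioo a b then (h.memLp t ht).toLp else 0

section curve
variable {n : ℕ} {B : Set (Space n)} {a b : ℝ} {w : Space n → ℝ → ℝ}
  (h : ContinuousInL2 B a b w)

lemma l2Curve_of_mem {t : ℝ} (ht : t ∈ Ioo a b) : l2Curve h t = (h.memLp t ht).toLp := by
  simp [l2Curve, ht]

lemma continuousOn_l2Curve : ContinuousOn (l2Curve h) (Ioo a b) := by
  intro s hs
  apply ContinuousAt.continuousWithinAt
  unfold ContinuousAt
  rw [Lp.tendsto_Lp_iff_tendsto_eLpNorm']
  refine (h.tendsto s hs).congr' ?_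
  filter_upwards [isOpen_Ioo.mem_nhds hs] with t ht
  rw [l2Curve_of_mem h hs, l2Curve_of_mem h ht]
  apply eLpNorm_congr_ae
  filter_upwards [(h.memLp t ht).coeFn_toLp, (h.memLp s hs).coeFn_toLp] with x h1 h2
  simp [h1, h2]

lemma inner_l2Curve {t : ℝ} (ht : t ∈ Ioo a b) {φ : Space n → ℝ}
    (hφ : MemLp φ 2 (volume.restrict B)) :
    inner ℝ (hφ.toLp) (l2Curve h t) = ∫ x in B, w x t * φ x := by
  rw [l2Curve_of_mem h ht, L2.inner_def]
  apply integral_congr_ae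
  filter_upwards [(h.memLp t ht).coeFn_toLp, hφ.coeFn_toLp] with x h1 h2
  simp [h1, h2]

lemma enorm_l2Curve {t : ℝ} (ht : t ∈ Ioo a b) :
    ‖l2Curve h t‖ₑ = eLpNorm (fun x => w x t) 2 (volume.restrict B) := by
  rw [l2Curve_of_mem h ht, Lp.enorm_toLp]

end curve

/-! ### Testing between two times with smooth functions. -/

namespace IsZeroBoundarySolution

variable {n : ℕ} {B : Set (Space n)} {a b : ℝ} {f : Space n → ℝ}
    {w : Space n → ℝ → ℝ} {A G : Space n × ℝ → Space n}

lemma isFiniteMeasure (h : IsZeroBoundarySolution B a b f w A G) :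
    IsFiniteMeasure (volume.restrict B) :=
  ⟨by rw [Measure.restrict_apply_univ]; exact h.volume_ne_top.lt_top⟩

/-- The equation tested with a time-independent test function between two times. -/
lemma sub_add_eq_of_contDiff (hn : 2 ≤ n) (h : IsZeroBoundarySolution B a b f w A G)
    {φ : Space n → ℝ} (hφ : ContDiff ℝ 1 φ) (hc : HasCompactSupport φ) (hsupp : tsupport φ ⊆ B)
    {s t : ℝ} (hs : s ∈ Ioo a b) (ht : t ∈ Ioo a b) (hst : s < t) :
    (∫ x in B, w x t * φ x) - (∫ x in B, w x s * φ x) +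
      ∫ z in B ×ˢ Ioo s t, inner ℝ (gradient φ z.1) (A z) = (t - s) * ∫ x in B, f x * φ x := by
  have := h.isFiniteMeasure
  have hfinQ : IsFiniteMeasure (volume.restrict (B ×ˢ Ioo a b)) := by
    rw [restrict_prod_eq]; infer_instance
  have hn1 : (1 : ℝ≥0∞) ≤ n := by exact_mod_cast (by omega : 1 ≤ n)
  have hφb : MemLp φ 2 (volume.restrict B) :=
    (hφ.continuous.memLp_of_hasCompactSupport hc).restrict B
  obtain ⟨M, hM⟩ := hc.exists_bound_of_continuous hφ.continuous
  have hgc : HasCompactSupport (gradient φ) :=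
    (hc.fderiv ℝ).comp_left (g := (InnerProductSpace.toDual ℝ (Space n)).symm) (by simp)
  obtain ⟨M', hM'⟩ := hgc.exists_bound_of_continuous (continuous_gradient hφ)
  have hwφ : Integrable (fun z : Space n × ℝ => w z.1 z.2 * φ z.1)
      ((volume.restrict B).prod (volume.restrict (Ioo a b))) := by
    rw [← restrict_prod_eq]
    refine (h.memLp.integrable hn1).mul_bdd (c := M) ?_ (ae_of_all _ fun z => hM z.1)
    exact (hφ.continuous.comp continuous_fst).aestronglyMeasurable
  have hAφ : Integrable (fun z : Space n × ℝ => inner ℝ (gradient φ z.1) (A z))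
      ((volume.restrict B).prod (volume.restrict (Ioo a b))) := by
    rw [← restrict_prod_eq]
    have hA := h.memLp_flux.integrable (one_le_conjExp hn)
    refine (hA.norm.const_mul M').mono
      (((continuous_gradient hφ).comp continuous_fst).aestronglyMeasurable.inner
        hA.aestronglyMeasurable) (ae_of_all _ fun z => ?_)
    refine (norm_inner_le_norm _ _).trans ?_
    rw [Real.norm_eq_abs, abs_of_nonneg
      (mul_nonneg ((norm_nonneg _).trans (hM' z.1)) (norm_nonneg _))]
    exact mul_le_mul_of_nonneg_right (hM' _) (norm_nonneg _)
  set F := ∫ x in B, f x * φ x with hF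
  set α : ℝ → ℝ := fun τ => ∫ x in B, inner ℝ (gradient φ x) (A (x, τ)) with hα
  have hαint : IntegrableOn α (Ioo a b) := hAφ.integral_prod_right
  have hg : ContinuousOn (fun τ => ∫ x in B, w x τ * φ x) (Ioo a b) := by
    refine ContinuousOn.congr (f := fun τ => inner ℝ (hφb.toLp) (l2Curve h.continuousInL2 τ))
      ?_ fun τ hτ => (inner_l2Curve h.continuousInL2 hτ hφb).symm
    exact continuousOn_const.inner (continuousOn_l2Curve _)
  -- Separated test functions `φ(x) η(t)` say that `τ ↦ ∫ w(·,τ) φ` has weak derivative `F - α`. Its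
  -- continuity upgrades this to an identity between any two interior times.
  have key := sub_eq_setIntegral_of_weak_deriv (β := fun τ => F - α τ) hg
    ((integrable_const F).sub hαint) (fun η hη hηc hηs => ?_) hs ht hst
  · have hα2 : IntegrableOn α (Ioo s t) := hαint.mono_set (Ioo_subset_Ioo hs.1.le ht.2.le)
    have hA2 : ∫ z in B ×ˢ Ioo s t, inner ℝ (gradient φ z.1) (A z) = ∫ x in Ioo s t, α x := by
      rw [restrict_prod_eq, integral_prod_symm]
      rw [← restrict_prod_eq] at hAφ ⊢
      exact hAφ.mono_measure (Measure.restrict_mono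
        (prod_mono le_rfl (Ioo_subset_Ioo hs.1.le ht.2.le)) le_rfl)
    rw [integral_sub (integrable_const F) hα2, setIntegral_const] at key
    simp only [Real.volume_real_Ioo_of_le hst.le, smul_eq_mul] at key
    rw [hA2]
    linarith
  · obtain ⟨N, hN⟩ := hηc.exists_bound_of_continuous hη.continuous
    obtain ⟨N', hN'⟩ := hηc.deriv.exists_bound_of_continuous (hη.continuous_deriv le_rfl)
    have e := h.equation φ η hφ hc hsupp hη hηc hηs
    rw [restrict_prod_eq] at e
    have e1 : ∫ z, f z.1 * (φ z.1 * η z.2) ∂((volume.restrict B).prod (volume.restrict (Ioo a b)))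
        = F * ∫ τ in Ioo a b, η τ := by
      simp_rw [← mul_assoc]
      exact integral_prod_mul (fun x => f x * φ x) η
    have e2 : ∫ z, w z.1 z.2 * (φ z.1 * deriv η z.2)
        ∂((volume.restrict B).prod (volume.restrict (Ioo a b))) =
        ∫ τ in Ioo a b, (∫ x in B, w x τ * φ x) * deriv η τ := by
      simp_rw [← mul_assoc]
      rw [integral_prod_symm (fun z => w z.1 z.2 * φ z.1 * deriv η z.2) (hwφ.mul_bdd (c := N') ((hη.continuous_deriv le_rfl).comp
        continuous_snd).aestronglyMeasurable (ae_of_all _ fun z => hN' z.2))]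
      simp_rw [integral_mul_const]
    have e3 : ∫ z, η z.2 * inner ℝ (gradient φ z.1) (A z)
        ∂((volume.restrict B).prod (volume.restrict (Ioo a b))) =
        ∫ τ in Ioo a b, α τ * η τ := by
      rw [integral_prod_symm (fun z => η z.2 * inner ℝ (gradient φ z.1) (A z)) (hAφ.bdd_mul (c := N) (hη.continuous.comp
        continuous_snd).aestronglyMeasurable (ae_of_all _ fun z => hN z.2))]
      simp_rw [integral_const_mul, hα, mul_comm]
    rw [e1, e2, e3] at e
    have hηi : IntegrableOn η (Ioo a b) := (hη.continuous.integrable_of_hasCompactSupport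
      hηc).integrableOn
    have e4 : ∫ x in Ioo a b, (F - α x) * η x =
        F * (∫ x in Ioo a b, η x) - ∫ x in Ioo a b, α x * η x := by
      simp_rw [sub_mul]
      rw [integral_sub (hηi.const_mul F), integral_const_mul]
      exact hαint.mul_bdd (c := N) hη.continuous.aestronglyMeasurable (ae_of_all _ hN)
    rw [e4]
    linarith

end IsZeroBoundarySolution

/-! ### Hölder pairings and passage to zero-trace test functions. -/

section holder
variable {X E : Type*} [MeasurableSpace X] {μ : Measure X} [NormedAddCommGroup E]
  [InnerProductSpace ℝ E] {p q : ℝ≥0∞}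

lemma lintegral_enorm_inner_le (hpq : ENNReal.HolderTriple p q 1) {g h : X → E}
    (hg : AEStronglyMeasurable g μ) (hh : AEStronglyMeasurable h μ) :
    ∫⁻ x, ‖(inner ℝ (g x) (h x) : ℝ)‖ₑ ∂μ ≤ eLpNorm g p μ * eLpNorm h q μ := by
  rw [← eLpNorm_one_eq_lintegral_enorm]
  refine (eLpNorm_le_eLpNorm_mul_eLpNorm'_of_norm (p := p) (q := q) hg hh
    (fun x y => inner ℝ x y) 1 (ae_of_all _ fun x => ?_)).trans (by simp)
  simpa using norm_inner_le_norm (𝕜 := ℝ) (g x) (h x)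

lemma integrable_inner_of_memLp (hpq : ENNReal.HolderTriple p q 1) {g h : X → E}
    (hg : MemLp g p μ) (hh : MemLp h q μ) : Integrable (fun x => (inner ℝ (g x) (h x) : ℝ)) μ := by
  refine ⟨hg.1.inner hh.1, ?_⟩
  exact (lintegral_enorm_inner_le hpq hg.1 hh.1).trans_lt (ENNReal.mul_lt_top hg.2 hh.2)

lemma tendsto_integral_inner (hpq : ENNReal.HolderTriple p q 1) {ι : Type*} {l : Filter ι}
    {g : ι → X → E} {g' h : X → E} (hg : ∀ i, MemLp (g i) p μ) (hg' : MemLp g' p μ)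
    (hh : MemLp h q μ) (hlim : Tendsto (fun i => eLpNorm (fun x => g i x - g' x) p μ) l (𝓝 0)) :
    Tendsto (fun i => ∫ x, (inner ℝ (g i x) (h x) : ℝ) ∂μ) l
      (𝓝 (∫ x, (inner ℝ (g' x) (h x) : ℝ) ∂μ)) := by
  apply tendsto_integral_of_L1 _ (hg'.1.inner hh.1)
    (Eventually.of_forall fun i => integrable_inner_of_memLp hpq (hg i) hh)
  have h0 : Tendsto (fun i => eLpNorm (fun x => g i x - g' x) p μ * eLpNorm h q μ) l (𝓝 0) := by
    simpa using ENNReal.Tendsto.mul_const hlim (Or.inr hh.eLpNorm_ne_top)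
  refine tendsto_of_tendsto_of_tendsto_of_le_of_le tendsto_const_nhds h0 (fun _ => zero_le)
    fun i => ?_
  simp_rw [← inner_sub_left]
  exact lintegral_enorm_inner_le hpq ((hg i).1.sub hg'.1) hh.1

end holder

lemma eLpNorm_comp_fst_le {X Y E : Type*} [MeasurableSpace X] [MeasurableSpace Y]
    [NormedAddCommGroup E] {p : ℝ≥0∞} {μ : Measure X} {ν : Measure Y} [IsFiniteMeasure ν]
    {g : X → E} (hg : AEStronglyMeasurable g μ) :
    eLpNorm (fun z : X × Y => g z.1) p (μ.prod ν) ≤ ν univ ^ (1 / p).toReal * eLpNorm g p μ := by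
  have h1 : eLpNorm (fun z : X × Y => g z.1) p (μ.prod ν) =
      eLpNorm g p ((μ.prod ν).map Prod.fst) := by
    rw [eLpNorm_map_measure _ measurable_fst.aemeasurable]
    · rfl
    · rw [Measure.map_fst_prod]
      exact hg.mono_ac Measure.smul_absolutelyContinuous
  rw [h1, Measure.map_fst_prod]
  exact (eLpNorm_smul_measure_le _ _ _ _)

/-- The datum term is not continuous under `L^n` convergence of the test functions. Orlicz duality
applied to `w - φ k` bounds the error by the `L^n` distance of the gradients. -/
lemma HasZeroTrace.tendsto_integral_mul {n : ℕ} (hn : 2 ≤ n) {B : Set (Space n)}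
    (hvol : volume B ≠ ⊤) {f : Space n → ℝ} (hf : IntegrableOn f B) (hfin : llogl B f ≠ ⊤)
    {w : Space n → ℝ} {G : Space n → Space n} (hw : AEStronglyMeasurable w (volume.restrict B))
    (hG : AEStronglyMeasurable G (volume.restrict B)) (h : HasZeroTrace n B w G)
    {φ : ℕ → Space n → ℝ} (hφ : ∀ k, ContDiff ℝ 1 (φ k)) (hc : ∀ k, HasCompactSupport (φ k))
    (hs : ∀ k, tsupport (φ k) ⊆ B)
    (hlim : Tendsto (fun k => eLpNorm (fun x => gradient (φ k) x - G x) n (volume.restrict B))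
      atTop (𝓝 0)) :
    Tendsto (fun k => ∫ x in B, f x * φ k x) atTop (𝓝 (∫ x in B, f x * w x)) := by
  apply tendsto_integral_of_L1 _ (hf.aestronglyMeasurable.mul hw)
  · refine Eventually.of_forall fun k => ?_
    obtain ⟨M, hM⟩ := (hc k).exists_bound_of_continuous (hφ k).continuous
    exact hf.mul_bdd (c := M) (hφ k).continuous.aestronglyMeasurable (ae_of_all _ hM)
  have h0 : Tendsto (fun k => 6 * sobolevConst n * llogl B f *
      eLpNorm (fun x => gradient (φ k) x - G x) n (volume.restrict B)) atTop (𝓝 0) := by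
    simpa using ENNReal.Tendsto.const_mul hlim
      (Or.inr (show 6 * sobolevConst n * llogl B f ≠ ⊤ by finiteness))
  refine tendsto_of_tendsto_of_tendsto_of_le_of_le tendsto_const_nhds h0 (fun _ => zero_le)
    fun k => ?_
  have := h.lintegral_mul_sub_le hn hvol hf hfin hw hG (hφ k) (hc k) (hs k)
  refine le_trans (le_of_eq (lintegral_congr fun x => ?_)) (this.trans (le_of_eq ?_))
  · rw [Pi.mul_apply, ← mul_sub, enorm_mul]
    congr 1
    rw [← enorm_neg, neg_sub]
  · congr 1
    rw [← eLpNorm_neg]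
    congr 1
    ext1 x
    simp

namespace IsZeroBoundarySolution

variable {n : ℕ} {B : Set (Space n)} {a b : ℝ} {f : Space n → ℝ}
    {w : Space n → ℝ → ℝ} {A G : Space n × ℝ → Space n}

lemma memLp_flux_restrict (h : IsZeroBoundarySolution B a b f w A G) {s t : ℝ}
    (hs : s ∈ Ioo a b) (ht : t ∈ Ioo a b) :
    MemLp A (conjExp n) ((volume.restrict B).prod (volume.restrict (Ioo s t))) := by
  rw [← restrict_prod_eq]
  exact h.memLp_flux.mono_measure (Measure.restrict_mono
    (prod_mono le_rfl (Ioo_subset_Ioo hs.1.le ht.2.le)) le_rfl)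

/-- The equation tested between two times with a time-independent function with zero trace. -/
lemma sub_add_eq_of_hasZeroTrace (hn : 2 ≤ n) (h : IsZeroBoundarySolution B a b f w A G)
    {ψ : Space n → ℝ} {H : Space n → Space n} (hψ : MemLp ψ n (volume.restrict B))
    (hψ2 : MemLp ψ 2 (volume.restrict B))
    (hH : MemLp H n (volume.restrict B)) (htr : HasZeroTrace n B ψ H)
    {s t : ℝ} (hs : s ∈ Ioo a b) (ht : t ∈ Ioo a b) (hst : s < t) :
    inner ℝ hψ2.toLp (l2Curve h.continuousInL2 t) - inner ℝ hψ2.toLp (l2Curve h.continuousInL2 s) +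
      ∫ z in B ×ˢ Ioo s t, inner ℝ (H z.1) (A z) = (t - s) * ∫ x in B, f x * ψ x := by
  have := h.isFiniteMeasure
  have hcopy := htr
  obtain ⟨φ, hφ, hφψ, hφH⟩ := htr
  have hφ1 : ∀ k, ContDiff ℝ 1 (φ k) := fun k => (hφ k).1.of_le (by exact_mod_cast le_top)
  have hφL : ∀ (p : ℝ≥0∞) k, MemLp (φ k) p (volume.restrict B) := fun p k =>
    ((hφ1 k).continuous.memLp_of_hasCompactSupport (hφ k).2.1).restrict B
  have hgL : ∀ k, MemLp (gradient (φ k)) n (volume.restrict B) := fun k =>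
    ((continuous_gradient (hφ1 k)).memLp_of_hasCompactSupport
      (((hφ k).2.1.fderiv ℝ).comp_left
        (g := (InnerProductSpace.toDual ℝ (Space n)).symm) (by simp))).restrict B
  -- Since `n ≥ 2` and `B` has finite measure, convergence in `L^n` implies convergence in `L²`,
  -- which the two energy pairings require.
  have hL2 : Tendsto (fun k => (hφL 2 k).toLp) atTop (𝓝 hψ2.toLp) := by
    rw [Lp.tendsto_Lp_iff_tendsto_eLpNorm'']
    have hbd : Tendsto (fun k => eLpNorm (fun x => φ k x - ψ x) n (volume.restrict B) *
        (volume.restrict B) univ ^ (1 / (2 : ℝ≥0∞).toReal - 1 / (n : ℝ≥0∞).toReal)) atTop (𝓝 0) := by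
      have h2 : 0 ≤ 1 / (2 : ℝ≥0∞).toReal - 1 / (n : ℝ≥0∞).toReal := by
        simp only [ENNReal.toReal_ofNat, ENNReal.toReal_natCast, sub_nonneg]
        apply one_div_le_one_div_of_le (by norm_num)
        exact_mod_cast hn
      simpa using ENNReal.Tendsto.mul_const hφψ (Or.inr
        (ENNReal.rpow_ne_top_of_nonneg h2 (measure_ne_top (volume.restrict B) univ)))
    refine tendsto_of_tendsto_of_tendsto_of_le_of_le tendsto_const_nhds hbd (fun _ => zero_le)
      fun k => ?_
    exact eLpNorm_le_eLpNorm_mul_rpow_measure_univ (by exact_mod_cast hn)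
      ((hφL 2 k).1.sub hψ2.1)
  have hl1 : ∀ τ, Tendsto (fun k => inner ℝ (hφL 2 k).toLp (l2Curve h.continuousInL2 τ)) atTop
      (𝓝 (inner ℝ hψ2.toLp (l2Curve h.continuousInL2 τ))) := fun τ =>
    hL2.inner tendsto_const_nhds
  have hl2 : Tendsto (fun k => ∫ z in B ×ˢ Ioo s t, inner ℝ (gradient (φ k) z.1) (A z)) atTop
      (𝓝 (∫ z in B ×ˢ Ioo s t, inner ℝ (H z.1) (A z))) := by
    rw [restrict_prod_eq]
    have hA := h.memLp_flux_restrict hs ht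
    have hT : ENNReal.HolderTriple (n : ℝ≥0∞) (conjExp n) 1 :=
      @ENNReal.HolderTriple.symm _ _ _ (holderTriple_conjExp hn)
    refine tendsto_integral_inner hT (g := fun k (z : Space n × ℝ) => gradient (φ k) z.1)
      (g' := fun z => H z.1) (fun k => (hgL k).comp_fst _) (hH.comp_fst _) hA ?_
    have hbd : Tendsto (fun k => (volume.restrict (Ioo s t)) univ ^ (1 / (n : ℝ≥0∞)).toReal *
        eLpNorm (fun x => gradient (φ k) x - H x) n (volume.restrict B)) atTop (𝓝 0) := by
      simpa using ENNReal.Tendsto.const_mul hφH (Or.inr (ENNReal.rpow_ne_top_of_nonneg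
        (by positivity) (measure_ne_top (volume.restrict (Ioo s t)) univ)))
    refine tendsto_of_tendsto_of_tendsto_of_le_of_le tendsto_const_nhds hbd (fun _ => zero_le)
      fun k => ?_
    exact eLpNorm_comp_fst_le (g := fun x => gradient (φ k) x - H x) ((hgL k).1.sub hH.1)
  have hl3 := (hcopy.tendsto_integral_mul hn h.volume_ne_top h.integrableOn h.llogl_ne_top hψ.1
    hH.1 hφ1 (fun k => (hφ k).2.1) (fun k => (hφ k).2.2) hφH).const_mul (t - s)
  refine tendsto_nhds_unique (((hl1 t).sub (hl1 s)).add hl2) (hl3.congr fun k => ?_)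
  rw [inner_l2Curve _ ht, inner_l2Curve _ hs]
  exact (h.sub_add_eq_of_contDiff hn (hφ1 k) (hφ k).2.1 (hφ k).2.2 hs ht hst).symm

end IsZeroBoundarySolution

lemma HasZeroTrace.memLp {n : ℕ} {q : ℝ≥0∞} {B : Set (Space n)} {w : Space n → ℝ}
    {G : Space n → Space n} (h : HasZeroTrace q B w G)
    (hw : AEStronglyMeasurable w (volume.restrict B)) : MemLp w q (volume.restrict B) := by
  obtain ⟨φ, hφ, hφw, -⟩ := h
  obtain ⟨k, hk⟩ := (hφw.eventually (gt_mem_nhds (by simp : (0 : ℝ≥0∞) < ⊤))).exists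
  have h1 : MemLp (φ k) q (volume.restrict B) :=
    ((hφ k).1.continuous.memLp_of_hasCompactSupport (hφ k).2.1).restrict B
  have h2 : MemLp (fun x => φ k x - w x) q (volume.restrict B) := ⟨h1.1.sub hw, hk⟩
  exact (h1.sub h2).ae_eq (ae_of_all _ fun x => by simp)

lemma HasZeroTrace.memLp_grad {n : ℕ} {q : ℝ≥0∞} {B : Set (Space n)}
    {w : Space n → ℝ} {G : Space n → Space n} (h : HasZeroTrace q B w G)
    (hG : AEStronglyMeasurable G (volume.restrict B)) : MemLp G q (volume.restrict B) := by
  obtain ⟨φ, hφ, -, hφG⟩ := h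
  obtain ⟨k, hk⟩ := (hφG.eventually (gt_mem_nhds (by simp : (0 : ℝ≥0∞) < ⊤))).exists
  have hφ1 : ContDiff ℝ 1 (φ k) := (hφ k).1.of_le (by exact_mod_cast le_top)
  have h1 : MemLp (gradient (φ k)) q (volume.restrict B) :=
    ((continuous_gradient hφ1).memLp_of_hasCompactSupport
      (((hφ k).2.1.fderiv ℝ).comp_left
        (g := (InnerProductSpace.toDual ℝ (Space n)).symm) (by simp))).restrict B
  have h2 : MemLp (fun x => gradient (φ k) x - G x) q (volume.restrict B) := ⟨h1.1.sub hG, hk⟩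
  exact (h1.sub h2).ae_eq (ae_of_all _ fun x => by simp)

/-! ### Time translations, correlations and their averages over short shifts. -/

instance isAddHaarMeasure_spaceTime (n : ℕ) :
    (volume : Measure (Space n × ℝ)).IsAddHaarMeasure :=
  inferInstanceAs (Measure.IsAddHaarMeasure ((volume : Measure (Space n)).prod volume))

/-- Continuity of translations in `L^p`. -/
lemma tendsto_eLpNorm_translate {n : ℕ} {p : ℝ≥0∞} (hp1 : 1 ≤ p) (hp : p ≠ ⊤)
    {g : Space n × ℝ → Space n} (hg : MemLp g p volume) :
    Tendsto (fun v => eLpNorm (fun z => g (v + z) - g z) p volume) (𝓝 0) (𝓝 0) := by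
  have : Fact (1 ≤ p) := ⟨hp1⟩
  let τ : Space n × ℝ → C(Space n × ℝ, Space n × ℝ) := fun v => ContinuousMap.addLeft v
  have hτ : Continuous τ :=
    (ContinuousMap.curry ⟨fun y : (Space n × ℝ) × (Space n × ℝ) => y.1 + y.2,
      continuous_add⟩).continuous
  have hτm : ∀ v, MeasurePreserving (τ v) volume volume := fun v =>
    measurePreserving_add_left volume v
  have hc : Continuous (fun v => Lp.compMeasurePreserving (τ v) (hτm v) hg.toLp) :=
    continuous_const.compMeasurePreservingLp hτ hτm hp
  have h0 := hc.tendsto 0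
  rw [Lp.tendsto_Lp_iff_tendsto_eLpNorm'] at h0
  refine h0.congr fun v => ?_
  simp_rw [Lp.toLp_compMeasurePreserving]
  apply eLpNorm_congr_ae
  filter_upwards [(hg.comp_measurePreserving (hτm v)).coeFn_toLp,
    (hg.comp_measurePreserving (hτm 0)).coeFn_toLp] with z h1 h2
  rw [Pi.sub_apply, h1, h2]
  simp [τ]

/-- Correlation in time of two vector fields. -/
noncomputable def timeCorrelation {n : ℕ} (A G : Space n × ℝ → Space n) (σ : ℝ) : ℝ :=
  ∫ z, inner ℝ (A ((0, -σ) + z)) (G z)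

lemma memLp_translate {n : ℕ} {p : ℝ≥0∞} {A : Space n × ℝ → Space n} (hA : MemLp A p volume)
    (v : Space n × ℝ) : MemLp (fun z => A (v + z)) p volume :=
  hA.comp_measurePreserving (measurePreserving_add_left volume v)

lemma tendsto_timeCorrelation {n : ℕ} (hn : 2 ≤ n) {A G : Space n × ℝ → Space n}
    (hA : MemLp A (conjExp n) volume) (hG : MemLp G n volume) :
    Tendsto (timeCorrelation A G) (𝓝 0) (𝓝 (∫ z, inner ℝ (A z) (G z))) := by
  have hv : Tendsto (fun σ : ℝ => ((0, -σ) : Space n × ℝ)) (𝓝 0) (𝓝 0) := by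
    have : Continuous (fun σ : ℝ => ((0, -σ) : Space n × ℝ)) := by fun_prop
    have h0 := this.tendsto 0
    rwa [neg_zero, Prod.mk_zero_zero] at h0
  exact tendsto_integral_inner (holderTriple_conjExp hn)
    (g := fun σ z => A ((0, -σ) + z)) (fun σ => memLp_translate hA _) hA hG
    ((tendsto_eLpNorm_translate (one_le_conjExp hn) (by simp [conjExp]) hA).comp hv)

/-- Hölder and translation invariance bound the pairing uniformly in the shift, so a finite measure
of shifts can be added. This licenses Fubini between shifts and space-time. -/
lemma integrable_timeCorrelation {n : ℕ} (hn : 2 ≤ n) {A G : Space n × ℝ → Space n}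
    (hAm : StronglyMeasurable A) (hGm : StronglyMeasurable G)
    (hA : MemLp A (conjExp n) volume) (hG : MemLp G n volume) (ν : Measure ℝ)
    [IsFiniteMeasure ν] :
    Integrable (fun y : (Space n × ℝ) × ℝ => (inner ℝ (A ((0, -y.2) + y.1)) (G y.1) : ℝ))
      (volume.prod ν) := by
  have hm : StronglyMeasurable
      (fun y : (Space n × ℝ) × ℝ => (inner ℝ (A ((0, -y.2) + y.1)) (G y.1) : ℝ)) := by
    refine StronglyMeasurable.inner (hAm.comp_measurable ?_) (hGm.comp_measurable measurable_fst)
    fun_prop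
  refine ⟨hm.aestronglyMeasurable, ?_⟩
  rw [HasFiniteIntegral, lintegral_prod_symm' _ hm.enorm]
  calc _ ≤ ∫⁻ _, eLpNorm A (conjExp n) volume * eLpNorm G n volume ∂ν := by
        refine lintegral_mono fun σ => ?_
        have h := lintegral_enorm_inner_le (holderTriple_conjExp hn)
          (memLp_translate hA (0, -σ)).1 hG.1
        rw [show eLpNorm (fun z => A ((0, -σ) + z)) (conjExp n) volume =
          eLpNorm A (conjExp n) volume from
          eLpNorm_comp_measurePreserving hA.1 (measurePreserving_add_left volume _)] at h
        exact h
    _ < ⊤ := by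
        rw [lintegral_const]
        have := hA.2
        have := hG.2
        finiteness

/-- If the averages of `k` over short intervals `(0,h)` are at most `M`, so is its limit at `0`. -/
lemma le_of_setIntegral_le_of_lt {k : ℝ → ℝ} {l M c : ℝ} (hc : 0 < c) (hk : Tendsto k (𝓝 0) (𝓝 l))
    (hint : ∀ h, 0 < h → h < c → IntegrableOn k (Ioo 0 h))
    (hle : ∀ h, 0 < h → h < c → ∫ σ in Ioo 0 h, k σ ≤ h * M) : l ≤ M := by
  by_contra! hlt
  have hev : ∀ᶠ σ in 𝓝 (0 : ℝ), (l + M) / 2 < k σ := hk.eventually (lt_mem_nhds (by linarith))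
  obtain ⟨d, hd, hdk⟩ := Metric.eventually_nhds_iff_ball.1 hev
  set h := min d c / 2 with hh
  have hm : 0 < min d c := lt_min hd hc
  have h0 : 0 < h := by positivity
  have hhd : h < d := by have := min_le_left d c; linarith
  have hhc : h < c := by have := min_le_right d c; linarith
  have h1 : ∫ _ in Ioo 0 h, (l + M) / 2 ≤ ∫ σ in Ioo 0 h, k σ := by
    refine setIntegral_mono_on (by simp) (hint h h0 hhc) measurableSet_Ioo fun σ hσ => ?_
    refine (hdk σ ?_).le
    rw [Real.ball_eq_Ioo]
    exact ⟨by linarith [hσ.1], by linarith [hσ.2]⟩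
  rw [setIntegral_const, Real.volume_real_Ioo_of_le h0.le, smul_eq_mul, sub_zero] at h1
  have := hle h h0 hhc
  have h2 : h * ((l + M) / 2) ≤ h * M := h1.trans this
  have := le_of_mul_le_mul_left h2 h0
  linarith

lemma setIntegral_comp_sub_left {F : ℝ → ℝ} {t h : ℝ} (hh : 0 ≤ h) :
    ∫ σ in Ioo 0 h, F (t - σ) = ∫ τ in Ioo (t - h) t, F τ := by
  rw [← integral_Ioc_eq_integral_Ioo, ← integral_Ioc_eq_integral_Ioo,
    ← intervalIntegral.integral_of_le hh, ← intervalIntegral.integral_of_le (by linarith),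
    intervalIntegral.integral_comp_sub_left, sub_zero]

/-- `G(·,t)` tested against `A` on the time interval `(t - h, t)`. -/
noncomputable def backwardPairing {n : ℕ} (B : Set (Space n)) (A G : Space n × ℝ → Space n)
    (h t : ℝ) : ℝ := ∫ z in B ×ˢ Ioo (t - h) t, inner ℝ (G (z.1, t)) (A z)

namespace IsZeroBoundarySolution

variable {n : ℕ} {B : Set (Space n)} {a b : ℝ} {f : Space n → ℝ}
    {w : Space n → ℝ → ℝ} {A G : Space n × ℝ → Space n}

lemma ae_memLp (h : IsZeroBoundarySolution B a b f w A G) :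
    ∀ᵐ t ∂(volume.restrict (Ioo a b)), HasZeroTrace n B (fun x => w x t) (fun x => G (x, t)) ∧
      MemLp (fun x => w x t) n (volume.restrict B) ∧
      MemLp (fun x => G (x, t)) n (volume.restrict B) := by
  filter_upwards [h.trace, ae_restrict_mem measurableSet_Ioo] with t ht htI
  exact ⟨ht, ht.memLp (h.continuousInL2.memLp t htI).1, ht.memLp_grad
    (h.stronglyMeasurable_grad.comp_measurable measurable_prodMk_right).aestronglyMeasurable⟩

lemma integral_prod_backward (hn : 2 ≤ n) (h : IsZeroBoundarySolution B a b f w A G)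
    {H : Space n → Space n} (hH : MemLp H n (volume.restrict B)) {d t : ℝ} (hd : 0 ≤ d)
    (hs : t - d ∈ Ioo a b) (ht : t ∈ Ioo a b) :
    ∫ z in B ×ˢ Ioo (t - d) t, inner ℝ (H z.1) (A z) =
      ∫ x in B, ∫ σ in Ioo 0 d, inner ℝ (H x) (A (x, t - σ)) := by
  have hT : ENNReal.HolderTriple (n : ℝ≥0∞) (conjExp n) 1 :=
    @ENNReal.HolderTriple.symm _ _ _ (holderTriple_conjExp hn)
  rw [restrict_prod_eq, integral_prod _ (integrable_inner_of_memLp hT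
    (hH.comp_fst (volume.restrict (Ioo (t - d) t))) (h.memLp_flux_restrict hs ht))]
  congr 1
  ext1 x
  exact (setIntegral_comp_sub_left (F := fun τ => inner ℝ (H x) (A (x, τ))) hd).symm

/-- Fubini with `τ = t - σ`. The flux is cut off to all of `(a,b)` but the gradient only to
`(s₁,s₂)`: as `s₁ - d > a`, a point shifted back by `σ < d` stays in the cylinder, and the cutoff of
`A` has no effect. -/
lemma setIntegral_timeCorrelation (hn : 2 ≤ n) (h : IsZeroBoundarySolution B a b f w A G)
    {s₁ s₂ d : ℝ} (hd : 0 < d) (hs₁ : a < s₁ - d) (hs₂ : s₂ < b) :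
    IntegrableOn (backwardPairing B A G d) (Ioo s₁ s₂) ∧
    IntegrableOn (timeCorrelation ((B ×ˢ Ioo a b).indicator A) ((B ×ˢ Ioo s₁ s₂).indicator G))
      (Ioo 0 d) ∧
    ∫ σ in Ioo 0 d, timeCorrelation ((B ×ˢ Ioo a b).indicator A) ((B ×ˢ Ioo s₁ s₂).indicator G) σ =
      ∫ t in Ioo s₁ s₂, backwardPairing B A G d t := by
  set Q := B ×ˢ Ioo a b with hQ
  set R := B ×ˢ Ioo s₁ s₂ with hR
  have hQm : MeasurableSet Q := h.measurableSet.prod measurableSet_Ioo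
  have hRm : MeasurableSet R := h.measurableSet.prod measurableSet_Ioo
  have hsub : Ioo s₁ s₂ ⊆ Ioo a b := Ioo_subset_Ioo (by linarith) hs₂.le
  have hint := integrable_timeCorrelation hn (h.stronglyMeasurable_flux.indicator hQm)
    (h.stronglyMeasurable_grad.indicator hRm) ((memLp_indicator_iff_restrict hQm).2 h.memLp_flux)
    ((memLp_indicator_iff_restrict hRm).2 (h.memLp_grad.mono_measure
      (Measure.restrict_mono (prod_mono le_rfl hsub) le_rfl))) (volume.restrict (Ioo 0 d))
  set Ψ : Space n × ℝ → ℝ := fun z => ∫ σ in Ioo 0 d,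
    inner ℝ (Q.indicator A ((0, -σ) + z)) (R.indicator G z) with hΨ
  have hΨint : Integrable Ψ ((volume : Measure (Space n)).prod (volume : Measure ℝ)) :=
    hint.integral_prod_left
  have hslice : ∀ᵐ t ∂(volume : Measure ℝ),
      ∫ x, Ψ (x, t) = (Ioo s₁ s₂).indicator (backwardPairing B A G d) t := by
    filter_upwards [(ae_restrict_iff' measurableSet_Ioo).1 (h.ae_memLp)] with t ht
    by_cases htI : t ∈ Ioo s₁ s₂
    · rw [indicator_of_mem htI, backwardPairing]
      have e := h.integral_prod_backward hn (ht (hsub htI)).2.2 hd.le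
        (t := t) ⟨by linarith [htI.1], by linarith [htI.2]⟩ (hsub htI)
      rw [e, ← integral_indicator h.measurableSet]
      congr 1
      ext1 x
      by_cases hx : x ∈ B
      · rw [indicator_of_mem hx, hΨ]
        refine setIntegral_congr_fun measurableSet_Ioo fun σ hσ => ?_
        have h1 : ((0, -σ) + (x, t) : Space n × ℝ) = (x, t - σ) := by
          ext1
          · simp
          · simp; ring
        have h2 : (x, t - σ) ∈ Q := ⟨hx, by
          simp only [mem_Ioo] at hσ htI ⊢; constructor <;> linarith⟩
        have h3 : (x, t) ∈ R := ⟨hx, htI⟩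
        beta_reduce
        rw [h1, indicator_of_mem h2, indicator_of_mem h3, real_inner_comm]
      · have h3 : (x, t) ∉ R := fun hh => hx hh.1
        rw [indicator_of_notMem hx]
        simp [hΨ, indicator_of_notMem h3]
    · rw [indicator_of_notMem htI]
      have h3 : ∀ x, (x, t) ∉ R := fun x hh => htI hh.2
      simp [hΨ, indicator_of_notMem (h3 _)]
  refine ⟨?_, hint.integral_prod_right, ?_⟩
  · rw [← integrable_indicator_iff measurableSet_Ioo]
    exact hΨint.integral_prod_right.congr hslice
  · rw [← integral_indicator (f := backwardPairing B A G d) measurableSet_Ioo,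
      ← integral_congr_ae hslice,
      ← integral_prod_symm Ψ hΨint]
    exact (integral_integral_swap (f := fun z σ =>
      inner ℝ (Q.indicator A ((0, -σ) + z)) (R.indicator G z)) hint).symm

/-! ### Energy inequalities. -/

/-- The energy inequality for time increments. -/
lemma energy_increment_le (hn : 2 ≤ n) (h : IsZeroBoundarySolution B a b f w A G) {κ : ℝ → ℝ}
    (hκ : ∀ᵐ t ∂(volume.restrict (Ioo a b)), ∫ x in B, f x * w x t ≤ κ t) {d : ℝ} (hd : 0 < d) :
    ∀ᵐ t ∂(volume.restrict (Ioo a b)), a < t - d →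
      ‖l2Curve h.continuousInL2 t‖ ^ 2 / 2 - ‖l2Curve h.continuousInL2 (t - d)‖ ^ 2 / 2 +
        backwardPairing B A G d t ≤ d * κ t := by
  filter_upwards [h.ae_memLp, ae_restrict_mem measurableSet_Ioo, hκ] with t ht htI hκt hat
  -- The test function is the slice at the later time, so that `⟨W, W - V⟩ ≥ (‖W‖² - ‖V‖²)/2` has
  -- the favourable sign.
  have e := h.sub_add_eq_of_hasZeroTrace hn ht.2.1 (h.continuousInL2.memLp t htI) ht.2.2 ht.1
    (s := t - d) ⟨hat, by linarith [htI.2]⟩ htI (by linarith)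
  rw [← l2Curve_of_mem h.continuousInL2 htI] at e
  rw [backwardPairing]
  set W := l2Curve h.continuousInL2 t
  set V := l2Curve h.continuousInL2 (t - d)
  have h1 : inner ℝ W W = ‖W‖ ^ 2 := real_inner_self_eq_norm_sq W
  have h2 : inner ℝ W V ≤ ‖W‖ * ‖V‖ := real_inner_le_norm W V
  have h3 : d * ∫ x in B, f x * w x t ≤ d * κ t := mul_le_mul_of_nonneg_left hκt hd.le
  rw [h1, sub_sub_cancel] at e
  nlinarith [sq_nonneg (‖W‖ - ‖V‖)]

/-- The energy inequality on an interior time interval. -/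
lemma energy_le (hn : 2 ≤ n) (h : IsZeroBoundarySolution B a b f w A G) {κ : ℝ → ℝ}
    (hκ : ∀ᵐ t ∂(volume.restrict (Ioo a b)), ∫ x in B, f x * w x t ≤ κ t)
    {s₁ s₂ ε : ℝ} (hκi : IntegrableOn κ (Ioo s₁ s₂))
    (hs₁ : a < s₁) (hs : s₁ < s₂) (hs₂ : s₂ < b)
    (hε : ∀ t ∈ Ioc a s₁, ‖l2Curve h.continuousInL2 t‖ ^ 2 / 2 ≤ ε) :
    ∫ z in B ×ˢ Ioo s₁ s₂, inner ℝ (A z) (G z) ≤ ε + ∫ t in Ioo s₁ s₂, κ t := by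
  set Q := B ×ˢ Ioo a b with hQ
  set R := B ×ˢ Ioo s₁ s₂ with hR
  have hQm : MeasurableSet Q := h.measurableSet.prod measurableSet_Ioo
  have hRm : MeasurableSet R := h.measurableSet.prod measurableSet_Ioo
  have hsub : Ioo s₁ s₂ ⊆ Ioo a b := Ioo_subset_Ioo hs₁.le hs₂.le
  have hRQ : R ⊆ Q := prod_mono le_rfl hsub
  have hlim := tendsto_timeCorrelation hn ((memLp_indicator_iff_restrict hQm).2 h.memLp_flux)
    ((memLp_indicator_iff_restrict hRm).2 (h.memLp_grad.mono_measure
      (Measure.restrict_mono hRQ le_rfl)))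
  have hval : ∫ z, inner ℝ (Q.indicator A z) (R.indicator G z) = ∫ z in R, inner ℝ (A z) (G z) := by
    rw [← integral_indicator hRm]
    congr 1
    ext1 z
    by_cases hz : z ∈ R
    · simp [indicator_of_mem hz, indicator_of_mem (hRQ hz)]
    · simp [indicator_of_notMem hz]
  rw [hval] at hlim
  set E : ℝ → ℝ := fun t => ‖l2Curve h.continuousInL2 t‖ ^ 2 / 2 with hE
  have hEc : ContinuousOn E (Ioo a b) :=
    ((continuousOn_l2Curve h.continuousInL2).norm.pow 2).div_const 2
  have hEi : ∀ p q, p ∈ Ioo a b → q ∈ Ioo a b → IntervalIntegrable E volume p q := fun p q hp hq =>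
    (hEc.mono ((convex_Ioo a b).ordConnected.uIcc_subset hp hq)).intervalIntegrable
  refine le_of_setIntegral_le_of_lt (sub_pos.2 hs₁) hlim (fun d hd hdc => ?_) (fun d hd hdc => ?_)
  · exact (h.setIntegral_timeCorrelation hn hd (by linarith) hs₂).2.1
  obtain ⟨hJ, -, heq⟩ :=
    h.setIntegral_timeCorrelation hn (s₁ := s₁) hd (by linarith) hs₂
  rw [heq]
  have m1 : s₁ ∈ Ioo a b := ⟨hs₁, by linarith⟩
  have m2 : s₂ ∈ Ioo a b := ⟨by linarith, hs₂⟩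
  have m3 : s₁ - d ∈ Ioo a b := ⟨by linarith, by linarith⟩
  have m4 : s₂ - d ∈ Ioo a b := ⟨by linarith, by linarith⟩
  have hE1 : IntegrableOn E (Ioo s₁ s₂) := by
    rw [← intervalIntegrable_iff_integrableOn_Ioo_of_le hs.le]; exact hEi _ _ m1 m2
  have hE2 : IntegrableOn (fun t => E (t - d)) (Ioo s₁ s₂) := by
    rw [← intervalIntegrable_iff_integrableOn_Ioo_of_le hs.le]
    simpa using (hEi _ _ m3 m4).comp_sub_right d
  have hmono : ∫ t in Ioo s₁ s₂, backwardPairing B A G d t ≤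
      ∫ t in Ioo s₁ s₂, (d * κ t + E (t - d) - E t) := by
    refine setIntegral_mono_ae_restrict hJ (((hκi.const_mul d).add hE2).sub hE1) ?_
    filter_upwards [ae_restrict_of_ae_restrict_of_subset hsub (h.energy_increment_le hn hκ hd),
      ae_restrict_mem measurableSet_Ioo] with t ht htI
    have := ht (by linarith [htI.1])
    simp only [hE]
    linarith
  -- The energies telescope to integrals over two end intervals of length `d`. The one before `s₂`
  -- is nonnegative and dropped; the one before `s₁` is at most `d * ε`.
  have hsplit : ∫ t in Ioo s₁ s₂, (d * κ t + E (t - d) - E t) =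
      d * (∫ t in Ioo s₁ s₂, κ t) + (∫ t in (s₁ - d)..s₁, E t) - ∫ t in (s₂ - d)..s₂, E t := by
    rw [integral_sub, integral_add (hκi.const_mul d) hE2, integral_const_mul,
      ← integral_Ioc_eq_integral_Ioo (f := fun t => E (t - d)),
      ← integral_Ioc_eq_integral_Ioo (f := E), ← intervalIntegral.integral_of_le hs.le,
      ← intervalIntegral.integral_of_le hs.le, intervalIntegral.integral_comp_sub_right]
    · have i1 := intervalIntegral.integral_add_adjacent_intervals (hEi _ _ m3 m1) (hEi _ _ m1 m2)
      have i2 := intervalIntegral.integral_add_adjacent_intervals (hEi _ _ m3 m4) (hEi _ _ m4 m2)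
      linarith
    · exact (hκi.const_mul d).add hE2
    · exact hE1
  have hpos : 0 ≤ ∫ t in (s₂ - d)..s₂, E t :=
    intervalIntegral.integral_nonneg (by linarith) fun t _ => by positivity
  have hsmall : ∫ t in (s₁ - d)..s₁, E t ≤ d * ε := by
    have := intervalIntegral.integral_mono_on (by linarith : s₁ - d ≤ s₁) (hEi _ _ m3 m1)
      (intervalIntegrable_const (c := ε)) fun t ht => hε t ⟨by linarith [ht.1], ht.2⟩
    simpa using this
  linarith

end IsZeroBoundarySolution

/-! ### Slice norms and the gradient bound. -/

/-- The norm in `Lⁿ(B)` of the time slice of a vector field. -/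
noncomputable def sliceNorm {n : ℕ} (B : Set (Space n)) (G : Space n × ℝ → Space n) (t : ℝ) :
    ℝ≥0∞ := (∫⁻ x in B, ‖G (x, t)‖ₑ ^ (n : ℝ)) ^ (1 / (n : ℝ))

/-- Writing the slice norm as a power of a lower integral makes this measurability in `t` a case of
Tonelli's theorem. -/
lemma measurable_sliceNorm {n : ℕ} (B : Set (Space n)) {G : Space n × ℝ → Space n}
    (hG : StronglyMeasurable G) : Measurable (sliceNorm B G) := by
  have h : Measurable (fun z : Space n × ℝ => ‖G z‖ₑ ^ (n : ℝ)) := hG.enorm.pow_const _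
  exact (h.lintegral_prod_left' (μ := volume.restrict B)).pow_const _

lemma sliceNorm_eq {n : ℕ} (hn : 2 ≤ n) (B : Set (Space n)) (G : Space n × ℝ → Space n) (t : ℝ) :
    sliceNorm B G t = eLpNorm (fun x => G (x, t)) n (volume.restrict B) := by
  rw [eLpNorm_natCast hn, sliceNorm]

lemma setLIntegral_prod_eq_slice {n : ℕ} (B : Set (Space n)) (I : Set ℝ)
    {G : Space n × ℝ → Space n} (hG : StronglyMeasurable G) :
    ∫⁻ z in B ×ˢ I, ‖G z‖ₑ ^ (n : ℝ) = ∫⁻ t in I, ∫⁻ x in B, ‖G (x, t)‖ₑ ^ (n : ℝ) := by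
  rw [restrict_prod_eq, lintegral_prod_symm' _ (hG.enorm.pow_const _)]

lemma lintegral_sliceNorm_le {n : ℕ} (hn : 2 ≤ n) (B : Set (Space n)) (I : Set ℝ)
    {G : Space n × ℝ → Space n} (hG : StronglyMeasurable G) :
    ∫⁻ t in I, sliceNorm B G t ≤
      (∫⁻ z in B ×ˢ I, ‖G z‖ₑ ^ (n : ℝ)) ^ (1 / (n : ℝ)) *
        volume I ^ (1 / ((n : ℝ) / (n - 1))) := by
  have hn0 : (n : ℝ) ≠ 0 := by positivity
  have h := ENNReal.lintegral_mul_le_Lp_mul_Lq (volume.restrict I) (holderConjugate_natCast hn)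
    (measurable_sliceNorm B hG).aemeasurable (g := fun _ => 1) aemeasurable_const
  simp only [Pi.mul_apply, mul_one, ENNReal.one_rpow, lintegral_const, one_mul,
    Measure.restrict_apply_univ] at h
  refine h.trans (le_of_eq ?_)
  rw [setLIntegral_prod_eq_slice B I hG]
  congr 3
  ext1 t
  rw [sliceNorm, ← ENNReal.rpow_mul, one_div_mul_cancel hn0, ENNReal.rpow_one]

namespace IsZeroBoundarySolution

variable {n : ℕ} {B : Set (Space n)} {a b : ℝ} {f : Space n → ℝ}
    {w : Space n → ℝ → ℝ} {A G : Space n × ℝ → Space n}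

lemma lintegral_grad_ne_top (hn : 2 ≤ n) (h : IsZeroBoundarySolution B a b f w A G) :
    ∫⁻ z in B ×ˢ Ioo a b, ‖G z‖ₑ ^ (n : ℝ) ≠ ⊤ := by
  have h1 := h.memLp_grad.eLpNorm_ne_top
  rw [eLpNorm_natCast hn] at h1
  intro htop
  rw [htop, ENNReal.top_rpow_of_pos (by positivity)] at h1
  exact h1 rfl

lemma initial_small (h : IsZeroBoundarySolution B a b f w A G) (hab : a < b) {ε : ℝ}
    (hε : 0 < ε) : ∀ᶠ s in 𝓝[>] a, ∀ t ∈ Ioc a s, ‖l2Curve h.continuousInL2 t‖ ^ 2 / 2 ≤ ε := by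
  have h1 : ∀ᶠ t in 𝓝[>] a, eLpNorm (fun x => w x t) 2 (volume.restrict B) <
      ENNReal.ofReal (√(2 * ε)) :=
    h.initial.eventually (gt_mem_nhds (by simpa using hε))
  obtain ⟨u, hu, huI⟩ := mem_nhdsGT_iff_exists_Ioo_subset.1 (h1.and (Ioo_mem_nhdsGT hab))
  filter_upwards [Ioo_mem_nhdsGT hu] with s hs t ht
  have h2 := huI (⟨ht.1, ht.2.trans_lt hs.2⟩ : t ∈ Ioo a u)
  have h3 := h2.1.le
  rw [← enorm_l2Curve h.continuousInL2 h2.2, ← ofReal_norm,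
    ENNReal.ofReal_le_ofReal_iff (by positivity)] at h3
  have h4 := pow_le_pow_left₀ (norm_nonneg _) h3 2
  rw [Real.sq_sqrt (by positivity)] at h4
  linarith

/-- The energy estimate: coercivity of the flux and Orlicz duality for the datum. -/
lemma lintegral_grad_le (hn : 2 ≤ n) (h : IsZeroBoundarySolution B a b f w A G) (hab : a < b)
    {c : ℝ} (hc : 0 ≤ c) (hcoer : ∀ᵐ z ∂(volume.restrict (B ×ˢ Ioo a b)),
      c * ‖G z‖ ^ (n : ℝ) ≤ inner ℝ (A z) (G z)) :
    ENNReal.ofReal c * ∫⁻ z in B ×ˢ Ioo a b, ‖G z‖ₑ ^ (n : ℝ) ≤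
      ∫⁻ t in Ioo a b, 6 * sobolevConst n * llogl B f * sliceNorm B G t := by
  set K := 6 * sobolevConst n * llogl B f with hK
  have hKfin : K ≠ ⊤ := by have := h.llogl_ne_top; finiteness
  have hGm := h.stronglyMeasurable_grad
  have hNm := measurable_sliceNorm B hGm
  set Z := ∫⁻ t in Ioo a b, K * sliceNorm B G t with hZ
  have hZfin : Z ≠ ⊤ := by
    rw [hZ, lintegral_const_mul _ hNm]
    refine ENNReal.mul_ne_top hKfin (ne_top_of_le_ne_top ?_ (lintegral_sliceNorm_le hn B _ hGm))
    refine ENNReal.mul_ne_top (ENNReal.rpow_ne_top_of_nonneg (by positivity)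
      (h.lintegral_grad_ne_top hn)) (ENNReal.rpow_ne_top_of_nonneg ?_ (by simp))
    have := (holderConjugate_natCast hn).symm.pos
    positivity
  -- An integrable majorant of `t ↦ ∫ f w(·,t)`; working with it makes measurability of that
  -- function in `t` irrelevant.
  set κ : ℝ → ℝ := fun t => (K * sliceNorm B G t).toReal with hκdef
  have hκ : ∀ᵐ t ∂(volume.restrict (Ioo a b)), ∫ x in B, f x * w x t ≤ κ t := by
    filter_upwards [h.ae_memLp] with t ht
    have h1 := ht.1.lintegral_mul_le hn h.volume_ne_top h.integrableOn h.llogl_ne_top ht.2.1.1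
      ht.2.2.1
    rw [← sliceNorm_eq hn B G t] at h1
    have hfin : K * sliceNorm B G t ≠ ⊤ := by
      refine ENNReal.mul_ne_top hKfin ?_
      rw [sliceNorm_eq hn]; exact ht.2.2.eLpNorm_ne_top
    have h2 := (enorm_integral_le_lintegral_enorm (μ := volume.restrict B)
      (fun x => f x * w x t)).trans ((lintegral_congr fun x => enorm_mul _ _).le.trans h1)
    have h3 := (ENNReal.toReal_mono hfin h2)
    rw [toReal_enorm] at h3
    exact (le_abs_self _).trans h3
  have hκi : IntegrableOn κ (Ioo a b) :=
    integrable_toReal_of_lintegral_ne_top (hNm.const_mul K).aemeasurable hZfin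
  have hκZ : ∀ s₁ s₂, Ioo s₁ s₂ ⊆ Ioo a b → ENNReal.ofReal (∫ t in Ioo s₁ s₂, κ t) ≤ Z := by
    intro s₁ s₂ hsub
    rw [ofReal_integral_eq_lintegral_ofReal (hκi.mono_set hsub)
      (ae_of_all _ fun _ => ENNReal.toReal_nonneg)]
    exact (lintegral_mono fun t => ENNReal.ofReal_toReal_le).trans (lintegral_mono_set hsub)
  have hmain : ∀ s₁ s₂ ε : ℝ, a < s₁ → s₁ < s₂ → s₂ < b → 0 < ε →
      (∀ t ∈ Ioc a s₁, ‖l2Curve h.continuousInL2 t‖ ^ 2 / 2 ≤ ε) →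
      ENNReal.ofReal c * ∫⁻ z in B ×ˢ Ioo s₁ s₂, ‖G z‖ₑ ^ (n : ℝ) ≤ Z + ENNReal.ofReal ε := by
    intro s₁ s₂ ε hs₁ hs hs₂ hε hsm
    have hsub : Ioo s₁ s₂ ⊆ Ioo a b := Ioo_subset_Ioo hs₁.le hs₂.le
    have hRQ : B ×ˢ Ioo s₁ s₂ ⊆ B ×ˢ Ioo a b := prod_mono le_rfl hsub
    have hmeas := Measure.restrict_mono hRQ (le_refl (volume : Measure (Space n × ℝ)))
    have hcoer' := ae_restrict_of_ae_restrict_of_subset hRQ hcoer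
    have hen := h.energy_le hn hκ (hκi.mono_set hsub) hs₁ hs hs₂ hsm
    have hint := integrable_inner_of_memLp (holderTriple_conjExp hn)
      (h.memLp_flux.mono_measure hmeas) (h.memLp_grad.mono_measure hmeas)
    calc ENNReal.ofReal c * ∫⁻ z in B ×ˢ Ioo s₁ s₂, ‖G z‖ₑ ^ (n : ℝ)
        = ∫⁻ z in B ×ˢ Ioo s₁ s₂, ENNReal.ofReal (c * ‖G z‖ ^ (n : ℝ)) := by
          rw [← lintegral_const_mul _ (hGm.enorm.pow_const _)]
          congr 1
          ext1 z
          rw [ENNReal.ofReal_mul hc, ← ofReal_norm,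
            ENNReal.ofReal_rpow_of_nonneg (norm_nonneg _) (by positivity)]
      _ ≤ ∫⁻ z in B ×ˢ Ioo s₁ s₂, ENNReal.ofReal (inner ℝ (A z) (G z)) := by
          apply lintegral_mono_ae
          filter_upwards [hcoer'] with z hz
          exact ENNReal.ofReal_le_ofReal hz
      _ = ENNReal.ofReal (∫ z in B ×ˢ Ioo s₁ s₂, inner ℝ (A z) (G z)) := by
          rw [ofReal_integral_eq_lintegral_ofReal hint]
          filter_upwards [hcoer'] with z hz
          exact le_trans (by positivity) hz
      _ ≤ ENNReal.ofReal (ε + ∫ t in Ioo s₁ s₂, κ t) := ENNReal.ofReal_le_ofReal hen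
      _ ≤ ENNReal.ofReal ε + ENNReal.ofReal (∫ t in Ioo s₁ s₂, κ t) := ENNReal.ofReal_add_le
      _ ≤ _ := by
          rw [add_comm]
          gcongr
          exact hκZ _ _ hsub
  have hsub : ∀ s₁ s₂ : ℝ, a < s₁ → s₁ < s₂ → s₂ < b →
      ENNReal.ofReal c * ∫⁻ z in B ×ˢ Ioo s₁ s₂, ‖G z‖ₑ ^ (n : ℝ) ≤ Z := by
    intro s₁ s₂ hs₁ hs hs₂
    refine ENNReal.le_of_forall_pos_le_add fun ε hε _ => ?_
    -- The left endpoint moves closer to `a`, where the energy is below `ε`. This only enlarges the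
    -- domain of integration, so the bound for the original interval follows.
    obtain ⟨s, hs', hsI⟩ := ((h.initial_small hab (NNReal.coe_pos.2 hε)).and
      (Ioo_mem_nhdsGT hs₁)).exists
    have := hmain s s₂ ε hsI.1 (hsI.2.trans hs) hs₂ hε hs'
    rw [ENNReal.ofReal_coe_nnreal] at this
    refine le_trans ?_ this
    gcongr
    exact hsI.2.le
  -- Exhaustion of `(a,b)` from inside. The factor `(b - a) / 4` keeps every interval nonempty,
  -- including the one for `k = 0`.
  have hcov : AECover (volume.restrict (Ioo a b)) atTop
      (fun k : ℕ => Ioo (a + (b - a) / 4 * (1 / ((k : ℝ) + 1)))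
        (b - (b - a) / 4 * (1 / ((k : ℝ) + 1)))) := by
    have h0 := (tendsto_one_div_add_atTop_nhds_zero_nat (𝕜 := ℝ)).const_mul ((b - a) / 4)
    apply aecover_Ioo_of_Ioo
    · simpa using h0.const_add a
    · simpa using h0.const_sub b
  have hlim := ENNReal.Tendsto.const_mul (a := ENNReal.ofReal c)
    (hcov.lintegral_tendsto_of_countably_generated
    (f := fun t => ∫⁻ x in B, ‖G (x, t)‖ₑ ^ (n : ℝ)) (Measurable.aemeasurable
      ((hGm.enorm.pow_const (n : ℝ)).lintegral_prod_left' (μ := volume.restrict B))))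
    (Or.inr ENNReal.ofReal_ne_top)
  rw [setLIntegral_prod_eq_slice B _ hGm]
  refine le_of_tendsto' hlim fun k => ?_
  have hk : 0 < (b - a) / 4 * (1 / ((k : ℝ) + 1)) := by
    have : 0 < b - a := sub_pos.2 hab
    positivity
  have hk1 : (b - a) / 4 * (1 / ((k : ℝ) + 1)) ≤ (b - a) / 4 := by
    refine mul_le_of_le_one_right (by linarith) ?_
    rw [div_le_one (by positivity)]
    linarith [k.cast_nonneg (α := ℝ)]
  rw [Measure.restrict_restrict measurableSet_Ioo, inter_eq_self_of_subset_left
    (Ioo_subset_Ioo (by linarith) (by linarith)), ← setLIntegral_prod_eq_slice B _ hGm]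
  exact hsub _ _ (by linarith) (by linarith) (by linarith)

/-- The gradient bound in terms of the `L log L` modular of the datum. -/
lemma rpow_lintegral_grad_le (hn : 2 ≤ n) (h : IsZeroBoundarySolution B a b f w A G) (hab : a < b)
    {c : ℝ} (hc : 0 < c) (hcoer : ∀ᵐ z ∂(volume.restrict (B ×ˢ Ioo a b)),
      c * ‖G z‖ ^ (n : ℝ) ≤ inner ℝ (A z) (G z)) :
    (∫⁻ z in B ×ˢ Ioo a b, ‖G z‖ₑ ^ (n : ℝ)) ^ (((n : ℝ) - 1) / n) ≤
      (ENNReal.ofReal c)⁻¹ * (6 * sobolevConst n * llogl B f) *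
        volume (Ioo a b) ^ (((n : ℝ) - 1) / n) := by
  set X := ∫⁻ z in B ×ˢ Ioo a b, ‖G z‖ₑ ^ (n : ℝ) with hX
  have hn2 : (2 : ℝ) ≤ n := by exact_mod_cast hn
  have hn0 : (n : ℝ) ≠ 0 := by positivity
  -- The factor `X ^ (1/n)` is cancelled below, which requires `X` to be neither `0` nor `⊤`.
  rcases eq_or_ne X 0 with h0 | h0
  · rw [h0, ENNReal.zero_rpow_of_pos (div_pos (by linarith) (by linarith))]
    exact zero_le
  have hXt : X ≠ ⊤ := h.lintegral_grad_ne_top hn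
  have h1 := h.lintegral_grad_le hn hab hc.le hcoer
  rw [lintegral_const_mul _ (measurable_sliceNorm B h.stronglyMeasurable_grad)] at h1
  have h2 := h1.trans (mul_le_mul_right
    (lintegral_sliceNorm_le hn B _ h.stronglyMeasurable_grad) _)
  have he : 1 / ((n : ℝ) / (n - 1)) = ((n : ℝ) - 1) / n := by rw [one_div_div]
  rw [he, ← hX] at h2
  have hsplit : X = X ^ (((n : ℝ) - 1) / n) * X ^ (1 / (n : ℝ)) := by
    rw [← ENNReal.rpow_add _ _ h0 hXt, ← add_div, sub_add_cancel, div_self hn0, ENNReal.rpow_one]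
  have hp0 : X ^ (1 / (n : ℝ)) ≠ 0 := by simp [h0, hXt]
  have hpt : X ^ (1 / (n : ℝ)) ≠ ⊤ := ENNReal.rpow_ne_top_of_nonneg (by positivity) hXt
  have hc0 : ENNReal.ofReal c ≠ 0 := by simpa using hc
  rw [← ENNReal.mul_le_mul_iff_left hp0 hpt, ← hsplit]
  calc X = (ENNReal.ofReal c)⁻¹ * (ENNReal.ofReal c * X) := by
        rw [← mul_assoc, ENNReal.inv_mul_cancel hc0 ENNReal.ofReal_ne_top, one_mul]
    _ ≤ _ := mul_le_mul_right h2 _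
    _ = _ := by ring

end IsZeroBoundarySolution

/-! ### The `p`-Laplace vector field. -/

section flux
variable {n : ℕ} {p : ℝ}

lemma norm_flux (hp : 2 ≤ p) (ζ : Space n) : ‖flux p ζ‖ = ‖ζ‖ ^ (p - 1) := by
  rw [flux, norm_smul, Real.norm_of_nonneg (by positivity)]
  rcases eq_or_ne ζ 0 with rfl | hζ
  · rw [norm_zero, mul_zero, Real.zero_rpow (by linarith)]
  · rw [← Real.rpow_add_one (norm_ne_zero_iff.2 hζ)]
    congr 1; ring

lemma continuous_flux (hp : 2 ≤ p) : Continuous (flux p : Space n → Space n) :=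
  (continuous_norm.rpow_const fun _ => Or.inr (by linarith)).smul continuous_id

/-- Strong monotonicity of the `p`-Laplace vector field for `p ≥ 2`. -/
lemma norm_sub_rpow_le_inner_flux (hp : 2 ≤ p) (x y : Space n) :
    ‖x - y‖ ^ p ≤ 2 ^ (p - 1) * inner ℝ (flux p x - flux p y) (x - y) := by
  set α := ‖x‖ ^ (p - 2) with hα
  set β := ‖y‖ ^ (p - 2) with hβ
  have hp2 : 0 ≤ p - 2 := by linarith
  have hα0 : 0 ≤ α := by positivity
  have hβ0 : 0 ≤ β := by positivity
  -- Symmetrised form of `⟨αx - βy, x - y⟩`. The last term is nonnegative because `α - β` and `‖x‖²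
  -- - ‖y‖²` have the same sign when `p ≥ 2`.
  have hid : inner ℝ (flux p x - flux p y) (x - y) =
      (α + β) / 2 * ‖x - y‖ ^ 2 + (α - β) * (‖x‖ ^ 2 - ‖y‖ ^ 2) / 2 := by
    have h1 := norm_sub_sq_real x y
    simp only [flux, inner_sub_left, inner_sub_right, real_inner_smul_left,
      real_inner_self_eq_norm_sq, real_inner_comm x y, ← hα, ← hβ]
    rw [h1]; ring
  have hmono : 0 ≤ (α - β) * (‖x‖ ^ 2 - ‖y‖ ^ 2) := by
    rcases le_total ‖x‖ ‖y‖ with h | h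
    · exact mul_nonneg_of_nonpos_of_nonpos
        (sub_nonpos.2 (Real.rpow_le_rpow (norm_nonneg _) h hp2))
        (sub_nonpos.2 (pow_le_pow_left₀ (norm_nonneg _) h 2))
    · exact mul_nonneg
        (sub_nonneg.2 (Real.rpow_le_rpow (norm_nonneg _) h hp2))
        (sub_nonneg.2 (pow_le_pow_left₀ (norm_nonneg _) h 2))
  -- From `‖x - y‖ ≤ 2 max(‖x‖, ‖y‖)`. Together with the factor `1/2` in `hid` this produces the
  -- constant `2 ^ (p - 1)`.
  have hmax : ‖x - y‖ ^ (p - 2) ≤ 2 ^ (p - 2) * (α + β) := by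
    have h1 : ‖x - y‖ ≤ 2 * max ‖x‖ ‖y‖ := by
      have := norm_sub_le x y
      have := le_max_left ‖x‖ ‖y‖
      have := le_max_right ‖x‖ ‖y‖
      linarith
    refine (Real.rpow_le_rpow (norm_nonneg _) h1 hp2).trans ?_
    rw [Real.mul_rpow (by norm_num) (by positivity)]
    gcongr
    rcases max_choice ‖x‖ ‖y‖ with h | h <;> rw [h] <;> linarith
  have hpow : ‖x - y‖ ^ p = ‖x - y‖ ^ (p - 2) * ‖x - y‖ ^ 2 := by
    rw [← Real.rpow_add_natCast' (norm_nonneg _) (by push_cast; linarith)]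
    congr 1; push_cast; ring
  have h2 : (2 : ℝ) ^ (p - 1) = 2 * 2 ^ (p - 2) := by
    rw [← Real.rpow_one_add' (by norm_num) (by linarith)]
    congr 1; ring
  rw [hpow, hid, h2]
  calc ‖x - y‖ ^ (p - 2) * ‖x - y‖ ^ 2 ≤ 2 ^ (p - 2) * (α + β) * ‖x - y‖ ^ 2 := by gcongr
    _ ≤ 2 ^ (p - 2) * (α + β) * ‖x - y‖ ^ 2 +
        2 ^ (p - 2) * ((α - β) * (‖x‖ ^ 2 - ‖y‖ ^ 2)) := by
        have : (0 : ℝ) ≤ 2 ^ (p - 2) * ((α - β) * (‖x‖ ^ 2 - ‖y‖ ^ 2)) :=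
          mul_nonneg (by positivity) hmono
        linarith
    _ = _ := by ring

lemma memLp_flux {X : Type*} [MeasurableSpace X] {μ : Measure X} (hn : 2 ≤ n) {F : X → Space n}
    (hF : MemLp F n μ) : MemLp (fun x => flux n (F x)) (conjExp n) μ := by
  have hn2 : (2 : ℝ) ≤ n := by exact_mod_cast hn
  have h1 := hF.norm_rpow_div (ENNReal.ofReal ((n : ℝ) - 1))
  rw [ENNReal.toReal_ofReal (by linarith), ← ENNReal.ofReal_natCast,
    ← ENNReal.ofReal_div_of_pos (by linarith)] at h1
  refine h1.mono ((continuous_flux hn2).comp_aestronglyMeasurable hF.1) (ae_of_all _ fun x => ?_)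
  rw [norm_flux hn2, Real.norm_of_nonneg (by positivity)]

end flux

/-! ### From the two weak solutions to the equation for their difference. -/

lemma fderiv_mul_prod {n : ℕ} {φ : Space n → ℝ} {η : ℝ → ℝ} (hφ : ContDiff ℝ 1 φ)
    (hη : ContDiff ℝ 1 η) (z y : Space n × ℝ) :
    fderiv ℝ (fun z : Space n × ℝ => φ z.1 * η z.2) z y =
      φ z.1 * (deriv η z.2 * y.2) + η z.2 * inner ℝ (gradient φ z.1) y.1 := by
  have h1 : HasFDerivAt (fun z : Space n × ℝ => φ z.1)
      ((fderiv ℝ φ z.1).comp (ContinuousLinearMap.fst ℝ (Space n) ℝ)) z :=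
    (hφ.differentiable one_ne_zero z.1).hasFDerivAt.comp z hasFDerivAt_fst
  have h2 : HasFDerivAt (fun z : Space n × ℝ => η z.2)
      ((fderiv ℝ η z.2).comp (ContinuousLinearMap.snd ℝ (Space n) ℝ)) z :=
    (hη.differentiable one_ne_zero z.2).hasFDerivAt.comp z hasFDerivAt_snd
  have h3 : HasFDerivAt (fun z : Space n × ℝ => φ z.1 * η z.2) _ z := h1.mul h2
  rw [h3.fderiv]
  simp [mul_comm]

/-- The weak equation on a subcylinder, tested with a product. -/
lemma IsWeakSolution.equation_prod {n : ℕ} {p : ℝ} {U B : Set (Space n)} {α β a b : ℝ}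
    {f : Space n → ℝ} {u : Space n → ℝ → ℝ} {Du : Space n → ℝ → Space n}
    (h : IsWeakSolution p U α β f u Du) (hU : MeasurableSet U) (hB : B ⊆ U)
    (hI : Ioo a b ⊆ Ioo α β) {φ : Space n → ℝ} {η : ℝ → ℝ} (hφ : ContDiff ℝ 1 φ)
    (hφc : HasCompactSupport φ) (hφs : tsupport φ ⊆ B) (hη : ContDiff ℝ 1 η)
    (hηc : HasCompactSupport η) (hηs : tsupport η ⊆ Ioo a b) :
    ∫ z in B ×ˢ Ioo a b, f z.1 * (φ z.1 * η z.2) =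
      - (∫ z in B ×ˢ Ioo a b, u z.1 z.2 * (φ z.1 * deriv η z.2)) +
        ∫ z in B ×ˢ Ioo a b, η z.2 * inner ℝ (gradient φ z.1) (flux p (Du z.1 z.2)) := by
  set Φ : Space n × ℝ → ℝ := fun z => φ z.1 * η z.2 with hΦ
  have hsub : B ×ˢ Ioo a b ⊆ U ×ˢ Ioo α β := prod_mono hB hI
  have hsupp : tsupport Φ ⊆ tsupport φ ×ˢ tsupport η := by
    apply closure_minimal _ ((isClosed_tsupport _).prod (isClosed_tsupport _))
    intro z hz
    exact ⟨subset_tsupport _ (left_ne_zero_of_mul hz), subset_tsupport _ (right_ne_zero_of_mul hz)⟩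
  have e := h.equation Φ ((hφ.comp contDiff_fst).mul (hη.comp contDiff_snd))
    (HasCompactSupport.of_support_subset_isCompact (hφc.isCompact.prod hηc.isCompact)
      ((subset_tsupport _).trans hsupp)) (hsupp.trans ((prod_mono hφs hηs).trans hsub))
  -- Off the small cylinder one factor vanishes together with its derivative, so all three integrals
  -- over the large cylinder localise.
  have hz : ∀ z : Space n × ℝ, z ∉ B ×ˢ Ioo a b →
      (φ z.1 = 0 ∧ gradient φ z.1 = 0) ∨ (η z.2 = 0 ∧ deriv η z.2 = 0) := by
    intro z hz
    rw [mem_prod, not_and_or] at hz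
    rcases hz with hz | hz
    · refine Or.inl ⟨image_eq_zero_of_notMem_tsupport fun h => hz (hφs h), ?_⟩
      rw [gradient, (LinearIsometryEquiv.map_eq_zero_iff _)]
      exact image_eq_zero_of_notMem_tsupport fun h =>
        hz (hφs (tsupport_fderiv_subset ℝ h))
    · refine Or.inr ⟨image_eq_zero_of_notMem_tsupport fun h => hz (hηs h), ?_⟩
      by_contra hne
      exact hz (hηs (support_deriv_subset hne))
  have hm : MeasurableSet (U ×ˢ Ioo α β) := hU.prod measurableSet_Ioo
  simp_rw [hΦ, fderiv_mul_prod hφ hη] at e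
  simp only [mul_one, mul_zero, inner_zero_right, add_zero, zero_add] at e
  rw [setIntegral_eq_of_subset_of_forall_sdiff_eq_zero hm hsub,
    setIntegral_eq_of_subset_of_forall_sdiff_eq_zero hm hsub,
    setIntegral_eq_of_subset_of_forall_sdiff_eq_zero hm hsub] at e
  · exact e
  · intro z hz'
    rcases hz z hz'.2 with h | h <;> simp [h]
  · intro z hz'
    rcases hz z hz'.2 with h | h <;> simp [h]
  · intro z hz'
    rcases hz z hz'.2 with h | h <;> simp [h]

lemma ContinuousInL2.mono {n : ℕ} {U B : Set (Space n)} {α β a b : ℝ} {u : Space n → ℝ → ℝ}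
    (h : ContinuousInL2 U α β u) (hB : B ⊆ U) (hI : Ioo a b ⊆ Ioo α β) :
    ContinuousInL2 B a b u where
  memLp t ht := (h.memLp t (hI ht)).mono_measure (Measure.restrict_mono hB le_rfl)
  tendsto s hs := tendsto_of_tendsto_of_tendsto_of_le_of_le tendsto_const_nhds
    (h.tendsto s (hI hs)) (fun _ => zero_le)
    fun _ => eLpNorm_mono_measure _ (Measure.restrict_mono hB le_rfl)

lemma ContinuousInL2.sub {n : ℕ} {B : Set (Space n)} {a b : ℝ} {u v : Space n → ℝ → ℝ}
    (hu : ContinuousInL2 B a b u) (hv : ContinuousInL2 B a b v) :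
    ContinuousInL2 B a b (fun x t => u x t - v x t) where
  memLp t ht := (hu.memLp t ht).sub (hv.memLp t ht)
  tendsto s hs := by
    have h0 := (hu.tendsto s hs).add (hv.tendsto s hs)
    rw [add_zero] at h0
    refine tendsto_of_tendsto_of_tendsto_of_le_of_le' tendsto_const_nhds h0
      (Eventually.of_forall fun _ => zero_le) ?_
    filter_upwards [isOpen_Ioo.mem_nhds hs] with t ht
    refine le_trans (le_of_eq ?_) (eLpNorm_sub_le ((hu.memLp t ht).1.sub (hu.memLp s hs).1)
      ((hv.memLp t ht).1.sub (hv.memLp s hs).1) (by norm_num))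
    congr 1
    ext1 x
    simp only [Pi.sub_apply]
    ring

lemma HasZeroTrace.congr_grad {n : ℕ} {q : ℝ≥0∞} {B : Set (Space n)} {w : Space n → ℝ}
    {G G' : Space n → Space n} (h : HasZeroTrace q B w G)
    (hG : G =ᵐ[volume.restrict B] G') : HasZeroTrace q B w G' := by
  obtain ⟨φ, hφ, h1, h2⟩ := h
  refine ⟨φ, hφ, h1, h2.congr fun k => eLpNorm_congr_ae ?_⟩
  filter_upwards [hG] with x hx
  rw [hx]

lemma ae_slice_of_ae_prod {n : ℕ} {B : Set (Space n)} {I : Set ℝ} {P : Space n × ℝ → Prop}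
    (h : ∀ᵐ z ∂(volume.restrict (B ×ˢ I)), P z) :
    ∀ᵐ t ∂(volume.restrict I), ∀ᵐ x ∂(volume.restrict B), P (x, t) := by
  rw [restrict_prod_eq] at h
  have h1 : ∀ᵐ z ∂((volume.restrict I).prod (volume.restrict B)), P z.swap :=
    Measure.measurePreserving_swap.quasiMeasurePreserving.ae h
  exact Measure.ae_ae_of_ae_prod h1

/-- The difference of a solution and its homogeneous replacement. -/
lemma exists_isZeroBoundarySolution {n : ℕ} (hn : 2 ≤ n) {Ω B : Set (Space n)} {α β a b : ℝ}
    {f : Space n → ℝ} {u v : Space n → ℝ → ℝ} {Du Dv : Space n → ℝ → Space n}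
    (hΩ : IsOpen Ω) (hu : IsWeakSolution n Ω α β f u Du) (hB : MeasurableSet B) (hBΩ : B ⊆ Ω)
    (hI : Ioo a b ⊆ Ioo α β) (hvol : volume B ≠ ⊤) (hf : IntegrableOn f B)
    (hfin : llogl B f ≠ ⊤) (hv : IsHomogeneousReplacement n B a b u Du v Dv) :
    ∃ A G : Space n × ℝ → Space n,
      IsZeroBoundarySolution B a b f (fun x t => u x t - v x t) A G ∧
      (∀ᵐ z ∂(volume.restrict (B ×ˢ Ioo a b)), Du z.1 z.2 - Dv z.1 z.2 = G z) ∧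
      ∀ᵐ z ∂(volume.restrict (B ×ˢ Ioo a b)),
        (2 ^ ((n : ℝ) - 1))⁻¹ * ‖G z‖ ^ (n : ℝ) ≤ inner ℝ (A z) (G z) := by
  have hn2 : (2 : ℝ) ≤ n := by exact_mod_cast hn
  have hn1 : (1 : ℝ≥0∞) ≤ n := by exact_mod_cast (by omega : 1 ≤ n)
  have hQ : B ×ˢ Ioo a b ⊆ Ω ×ˢ Ioo α β := prod_mono hBΩ hI
  have hQm := Measure.restrict_mono hQ (le_refl (volume : Measure (Space n × ℝ)))
  have hfinQ : IsFiniteMeasure (volume.restrict (B ×ˢ Ioo a b)) := by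
    have : IsFiniteMeasure (volume.restrict B) :=
      ⟨by rw [Measure.restrict_apply_univ]; exact hvol.lt_top⟩
    rw [restrict_prod_eq]; infer_instance
  have hu1 : MemLp (fun z : Space n × ℝ => u z.1 z.2) n (volume.restrict (B ×ˢ Ioo a b)) := by
    have := hu.inLqW1q.memLp.mono_measure hQm
    rwa [ENNReal.ofReal_natCast] at this
  have hDu : MemLp (fun z : Space n × ℝ => Du z.1 z.2) n (volume.restrict (B ×ˢ Ioo a b)) := by
    have := hu.inLqW1q.memLp_grad.mono_measure hQm
    rwa [ENNReal.ofReal_natCast] at this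
  have hv1 : MemLp (fun z : Space n × ℝ => v z.1 z.2) n (volume.restrict (B ×ˢ Ioo a b)) := by
    have := hv.solution.inLqW1q.memLp
    rwa [ENNReal.ofReal_natCast] at this
  have hDv : MemLp (fun z : Space n × ℝ => Dv z.1 z.2) n (volume.restrict (B ×ˢ Ioo a b)) := by
    have := hv.solution.inLqW1q.memLp_grad
    rwa [ENNReal.ofReal_natCast] at this
  have hFu := memLp_flux hn hDu
  have hFv := memLp_flux hn hDv
  have hG := hDu.sub hDv
  have hA := hFu.sub hFv
  have hGae := hG.1.ae_eq_mk
  have hAae := hA.1.ae_eq_mk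
  -- Strongly measurable representatives on all of space-time: slices at a fixed time and translates
  -- are then measurable without exceptional sets.
  refine ⟨hA.1.mk _, hG.1.mk _, ?_, ?_, ?_⟩
  · refine ⟨hB, hvol, hf, hfin, (hu.continuousInL2.mono hBΩ hI).sub hv.solution.continuousInL2,
      hu1.sub hv1, hA.1.stronglyMeasurable_mk, hG.1.stronglyMeasurable_mk, hA.ae_eq hAae,
      hG.ae_eq hGae, ?_, hv.initial, ?_⟩
    · filter_upwards [hv.lateral, ae_slice_of_ae_prod hGae] with t ht htG
      rw [ENNReal.ofReal_natCast] at ht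
      exact ht.congr_grad htG
    · intro φ η hφ hφc hφs hη hηc hηs
      have e1 := hu.equation_prod hΩ.measurableSet hBΩ hI hφ hφc hφs hη hηc hηs
      have e2 := hv.solution.equation_prod hB le_rfl le_rfl hφ hφc hφs hη hηc hηs
      obtain ⟨M, hM⟩ := hφc.exists_bound_of_continuous hφ.continuous
      obtain ⟨N, hN⟩ := hηc.exists_bound_of_continuous hη.continuous
      obtain ⟨N', hN'⟩ := hηc.deriv.exists_bound_of_continuous (hη.continuous_deriv le_rfl)
      have hgc : HasCompactSupport (gradient φ) :=
        (hφc.fderiv ℝ).comp_left (g := (InnerProductSpace.toDual ℝ (Space n)).symm) (by simp)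
      have hgL : MemLp (fun z : Space n × ℝ => gradient φ z.1) n
          (volume.restrict (B ×ˢ Ioo a b)) := by
        obtain ⟨M', hM'⟩ := hgc.exists_bound_of_continuous (continuous_gradient hφ)
        exact MemLp.of_bound ((continuous_gradient hφ).comp continuous_fst).aestronglyMeasurable
          M' (ae_of_all _ fun z => hM' z.1)
      have hT : ENNReal.HolderTriple (n : ℝ≥0∞) (conjExp n) 1 :=
        @ENNReal.HolderTriple.symm _ _ _ (holderTriple_conjExp hn)
      have hηm : AEStronglyMeasurable (fun z : Space n × ℝ => η z.2)
          (volume.restrict (B ×ˢ Ioo a b)) :=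
        (hη.continuous.comp continuous_snd).aestronglyMeasurable
      have hφηm : AEStronglyMeasurable (fun z : Space n × ℝ => φ z.1 * deriv η z.2)
          (volume.restrict (B ×ˢ Ioo a b)) :=
        ((hφ.continuous.comp continuous_fst).mul
          ((hη.continuous_deriv le_rfl).comp continuous_snd)).aestronglyMeasurable
      have hφηb : ∀ z : Space n × ℝ, ‖φ z.1 * deriv η z.2‖ ≤ M * N' := fun z => by
        rw [norm_mul]
        exact mul_le_mul (hM _) (hN' _) (norm_nonneg _) ((norm_nonneg _).trans (hM z.1))
      have i1 := (hu1.integrable hn1).mul_bdd (c := M * N') hφηm (ae_of_all _ hφηb)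
      have i2 := (hv1.integrable hn1).mul_bdd (c := M * N') hφηm (ae_of_all _ hφηb)
      have i3 := (integrable_inner_of_memLp hT hgL hFu).bdd_mul (c := N) hηm
        (ae_of_all _ fun z => hN z.2)
      have i4 := (integrable_inner_of_memLp hT hgL hFv).bdd_mul (c := N) hηm
        (ae_of_all _ fun z => hN z.2)
      have e3 : ∫ z in B ×ˢ Ioo a b, η z.2 * inner ℝ (gradient φ z.1) (hA.1.mk _ z) =
          (∫ z in B ×ˢ Ioo a b, η z.2 * inner ℝ (gradient φ z.1) (flux n (Du z.1 z.2))) -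
          ∫ z in B ×ˢ Ioo a b, η z.2 * inner ℝ (gradient φ z.1) (flux n (Dv z.1 z.2)) := by
        rw [← integral_sub i3 i4]
        apply integral_congr_ae
        filter_upwards [hAae] with z hz
        rw [← hz, Pi.sub_apply, inner_sub_right, mul_sub]
      have e4 : ∫ z in B ×ˢ Ioo a b, (u z.1 z.2 - v z.1 z.2) * (φ z.1 * deriv η z.2) =
          (∫ z in B ×ˢ Ioo a b, u z.1 z.2 * (φ z.1 * deriv η z.2)) -
          ∫ z in B ×ˢ Ioo a b, v z.1 z.2 * (φ z.1 * deriv η z.2) := by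
        rw [← integral_sub i1 i2]
        simp_rw [sub_mul]
      simp only [zero_mul, integral_zero] at e2
      rw [e3, e4, e1]
      linarith
  · filter_upwards [hGae] with z hz using hz
  · filter_upwards [hGae, hAae] with z hz hz'
    rw [← hz, ← hz', inv_mul_le_iff₀ (by positivity)]
    exact norm_sub_rpow_le_inner_flux hn2 _ _

/-- The datum is only locally integrable in `Ω`, and the ball may touch `∂Ω`. The default values do
no harm: for a non-integrable `f` the mean and the quotient are `0`, the logarithm is `1`, and the
modular is `∫ |f| = ∞`. -/
lemma integrableOn_of_llogl_ne_top {n : ℕ} {B : Set (Space n)} {f : Space n → ℝ}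
    (hf : AEStronglyMeasurable f (volume.restrict B)) (hfin : llogl B f ≠ ⊤) :
    IntegrableOn f B :=
  ⟨hf, (lintegral_enorm_le_llogl B f).trans_lt hfin.lt_top⟩

/-! ### Constants, scaling and the comparison estimate. -/

/-- The volume of the unit ball. -/
noncomputable def unitBallVolume (n : ℕ) : ℝ≥0∞ := volume (Metric.ball (0 : Space n) 1)

/-- The constant of the comparison estimate, before taking the root. -/
noncomputable def comparisonConst (n : ℕ) : ℝ≥0∞ :=
  (ENNReal.ofReal (2 ^ ((n : ℝ) - 1))⁻¹)⁻¹ * (6 * sobolevConst n) *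
    unitBallVolume n ^ (1 / (n : ℝ))

lemma comparisonConst_ne_top (n : ℕ) : comparisonConst n ≠ ⊤ := by
  have h1 : ENNReal.ofReal ((2 : ℝ) ^ ((n : ℝ) - 1))⁻¹ ≠ 0 := by
    rw [ne_eq, ENNReal.ofReal_eq_zero, not_le]; positivity
  refine ENNReal.mul_ne_top (ENNReal.mul_ne_top (ENNReal.inv_ne_top.2 h1) (by finiteness))
    (ENNReal.rpow_ne_top_of_nonneg (by positivity) measure_ball_lt_top.ne)

/-- Scaling of the gradient bound to averages over a cylinder. -/
lemma average_rpow_le {n : ℕ} (hn : 2 ≤ n) {K J X V I R v : ℝ≥0∞}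
    (hV : V = R ^ n * v) (hV0 : V ≠ 0) (hVt : V ≠ ⊤) (hI0 : I ≠ 0)
    (hIt : I ≠ ⊤)
    (h : X ^ (((n : ℝ) - 1) / n) ≤ K * J * I ^ (((n : ℝ) - 1) / n)) :
    (X / (V * I)) ^ (1 / (n : ℝ)) ≤
      (K * v ^ (1 / (n : ℝ))) ^ (1 / ((n : ℝ) - 1)) * (R * J / V) ^ (1 / ((n : ℝ) - 1)) := by
  have hn2 : (2 : ℝ) ≤ n := by exact_mod_cast hn
  have hn0 : (n : ℝ) ≠ 0 := by positivity
  have hn1 : (n : ℝ) - 1 ≠ 0 := by linarith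
  have hn1' : 0 < (n : ℝ) - 1 := by linarith
  set θ := ((n : ℝ) - 1) / n with hθ
  have hθ0 : 0 ≤ θ := by positivity
  have hθ1 : θ + 1 / n = 1 := by rw [hθ, ← add_div, sub_add_cancel, div_self hn0]
  have he : 1 / (n : ℝ) = θ * (1 / ((n : ℝ) - 1)) := by rw [hθ]; field_simp
  -- Averaging divides by `V ^ θ`, whereas the mean of the modular carries the full `1 / V`. The
  -- missing `V ^ (1/n)` is the radius times a dimensional constant.
  have hVr : V ^ (1 / (n : ℝ)) = R * v ^ (1 / (n : ℝ)) := by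
    rw [hV, ENNReal.mul_rpow_of_nonneg _ _ (by positivity), ← ENNReal.rpow_natCast,
      ← ENNReal.rpow_mul, mul_one_div_cancel hn0, ENNReal.rpow_one]
  have hVθ0 : V ^ θ ≠ 0 := by simp [hV0, hVt]
  have hVθt : V ^ θ ≠ ⊤ := ENNReal.rpow_ne_top_of_nonneg hθ0 hVt
  have hIθ0 : I ^ θ ≠ 0 := by simp [hI0, hIt]
  have hIθt : I ^ θ ≠ ⊤ := ENNReal.rpow_ne_top_of_nonneg hθ0 hIt
  have hVsplit : V = V ^ θ * V ^ (1 / (n : ℝ)) := by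
    rw [← ENNReal.rpow_add _ _ hV0 hVt, hθ1, ENNReal.rpow_one]
  have key : (X / (V * I)) ^ θ ≤ K * v ^ (1 / (n : ℝ)) * (R * J / V) := by
    rw [ENNReal.div_rpow_of_nonneg _ _ hθ0, ENNReal.mul_rpow_of_nonneg _ _ hθ0]
    apply ENNReal.div_le_of_le_mul
    refine h.trans (le_of_eq ?_)
    calc K * J * I ^ θ = K * J * I ^ θ * (V / V) := by rw [ENNReal.div_self hV0 hVt, mul_one]
      _ = K * J * I ^ θ * ((V ^ θ * V ^ (1 / (n : ℝ))) / V) := by rw [← hVsplit]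
      _ = _ := by rw [hVr]; simp only [div_eq_mul_inv]; ring
  rw [← ENNReal.mul_rpow_of_nonneg _ _ (by positivity)]
  conv_lhs => rw [he, ENNReal.rpow_mul]
  exact ENNReal.rpow_le_rpow key (by positivity)

end ParabolicPLaplace

open ParabolicPLaplace

theorem mainTheorem6 (n : ℕ) (hn : 2 ≤ n) :
    ∃ r₀ : ℝ, 0 < r₀ ∧ ∃ C : ℝ≥0,
      ∀ (Ω : Set (ParabolicPLaplace.Space n)) (T : ℝ) (f : ParabolicPLaplace.Space n → ℝ)
        (u v : ParabolicPLaplace.Space n → ℝ → ℝ)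
        (Du Dv : ParabolicPLaplace.Space n → ℝ → ParabolicPLaplace.Space n)
        (x₀ : ParabolicPLaplace.Space n) (t₀ lam r : ℝ),
        IsOpen Ω →
        ParabolicPLaplace.IsWeakSolution (n : ℝ) Ω 0 T f u Du →
        1 ≤ lam → 0 < r → r < r₀ →
        ParabolicPLaplace.cylinder (n : ℝ) lam r x₀ t₀ ⊆ Ω ×ˢ Ioo 0 T →
        ParabolicPLaplace.IsHomogeneousReplacement (n : ℝ) (Metric.ball x₀ r)
          (t₀ - lam ^ (2 - (n : ℝ)) * r ^ 2) (t₀ + lam ^ (2 - (n : ℝ)) * r ^ 2) u Du v Dv →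
        (⨍⁻ z in ParabolicPLaplace.cylinder (n : ℝ) lam r x₀ t₀,
            ‖Du z.1 z.2 - Dv z.1 z.2‖ₑ ^ n ∂volume) ^ (1 / (n : ℝ)) ≤
          C * (⨍⁻ x in Metric.ball x₀ r,
            ENNReal.ofReal (r * |f x| *
              Real.log (Real.exp 1 + |f x| / ⨍ y in Metric.ball x₀ r, |f y|)) ∂volume) ^
                (1 / ((n : ℝ) - 1)) := by
  have hn2 : (2 : ℝ) ≤ n := by exact_mod_cast hn
  have hn1 : (0 : ℝ) < 1 / ((n : ℝ) - 1) := one_div_pos.2 (by linarith)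
  have hCt : comparisonConst n ^ (1 / ((n : ℝ) - 1)) ≠ ⊤ :=
    ENNReal.rpow_ne_top_of_nonneg hn1.le (comparisonConst_ne_top n)
  -- The estimate is scale invariant, so `r₀ = 1` is an arbitrary choice. The summand `+ 1` keeps
  -- the constant nonzero, so that its product with an infinite right-hand side is `⊤`, not `0 * ⊤ =
  -- 0`.
  refine ⟨1, one_pos, (comparisonConst n ^ (1 / ((n : ℝ) - 1))).toNNReal + 1, ?_⟩
  intro Ω T f u v Du Dv x₀ t₀ lam r hΩ hu hlam hr _ hcyl hv
  have : Nonempty (Fin n) := ⟨⟨0, by omega⟩⟩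
  set B := Metric.ball x₀ r with hB
  set ρ := lam ^ (2 - (n : ℝ)) * r ^ 2 with hρ
  have hρ0 : 0 < ρ := by positivity
  have hab : t₀ - ρ < t₀ + ρ := by linarith
  have hQ : cylinder (n : ℝ) lam r x₀ t₀ = B ×ˢ Ioo (t₀ - ρ) (t₀ + ρ) := rfl
  rw [hQ] at hcyl ⊢
  obtain ⟨hBΩ, hI⟩ := (prod_subset_prod_iff.1 hcyl).resolve_right (by
    rw [not_or]
    exact ⟨(Metric.nonempty_ball.2 hr).ne_empty, (nonempty_Ioo.2 hab).ne_empty⟩)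
  have hV0 : volume B ≠ 0 := (Metric.measure_ball_pos volume x₀ hr).ne'
  have hVt : volume B ≠ ⊤ := measure_ball_lt_top.ne
  have hfm : AEStronglyMeasurable f (volume.restrict B) :=
    hu.datum.aestronglyMeasurable.mono_measure (Measure.restrict_mono hBΩ le_rfl)
  have hlog : ∫⁻ x in B, ENNReal.ofReal (r * |f x| *
      Real.log (Real.exp 1 + |f x| / ⨍ y in B, |f y|)) = ENNReal.ofReal r * llogl B f := by
    rw [llogl, ← lintegral_const_mul' _ _ ENNReal.ofReal_ne_top]
    congr 1
    ext1 x
    rw [mul_assoc, ENNReal.ofReal_mul hr.le]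
  rw [setLAverage_eq, setLAverage_eq, hlog, ENNReal.coe_add, ENNReal.coe_toNNReal hCt]
  have hR0 : ENNReal.ofReal r ≠ 0 := by simpa using hr
  by_cases hfin : llogl B f = ⊤
  · rw [hfin, ENNReal.mul_top hR0, ENNReal.top_div_of_ne_top hVt, ENNReal.top_rpow_of_pos hn1,
      ENNReal.mul_top (by simp)]
    exact le_top
  obtain ⟨A, G, hsol, hG, hcoer⟩ := exists_isZeroBoundarySolution hn hΩ hu
    Metric.isOpen_ball.measurableSet hBΩ hI hVt (integrableOn_of_llogl_ne_top hfm hfin) hfin hv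
  have hbound := hsol.rpow_lintegral_grad_le hn hab (by positivity) hcoer
  have hX : ∫⁻ z in B ×ˢ Ioo (t₀ - ρ) (t₀ + ρ), ‖Du z.1 z.2 - Dv z.1 z.2‖ₑ ^ n =
      ∫⁻ z in B ×ˢ Ioo (t₀ - ρ) (t₀ + ρ), ‖G z‖ₑ ^ (n : ℝ) := by
    apply lintegral_congr_ae
    filter_upwards [hG] with z hz
    rw [hz, ENNReal.rpow_natCast]
  have hI0 : volume (Ioo (t₀ - ρ) (t₀ + ρ)) ≠ 0 := by simpa using hρ0
  have hV : volume B = ENNReal.ofReal r ^ n * unitBallVolume n := by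
    rw [hB, Measure.addHaar_ball _ _ hr.le, finrank_euclideanSpace_fin,
      ENNReal.ofReal_pow hr.le, unitBallVolume]
  rw [← mul_assoc] at hbound
  have hfinal := average_rpow_le hn hV hV0 hVt hI0 (by simp) hbound
  rw [hX, Measure.volume_eq_prod, Measure.prod_prod]
  refine hfinal.trans ?_
  rw [comparisonConst]
  gcongr
  exact le_self_add
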